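/- Let $Q$ be a probability distribution on $\mathbb{R}$ with $\int x\,Q(dx)=0$, $\int x^2\,Q(dx)=1$ and $b:=\int x^4\,Q(dx)<\infty$. Let $X_{ij}=X_{ji}$ ($i,j\in\mathbb{N}$) be real random variables on a probability space such that the random variables $X_{ii}/\sqrt2$ ($i\in\mathbb{N}$) and $X_{ij}$ ($i<j$) are all independent with distribution $Q$. For $N\in\mathbb{N}$ let $X_N:=(X_{ij})_{1\le i,j\le N}$, and for $\mu,\nu\in\mathbb{C}$ let $$f(N;\mu,\nu):=\mathbb{E}\big(\det(X_N-\mu I_N)\cdot\det(X_N-\nu I_N)\big).$$ These expectations exist, i.e. the random variables $\det(X_N-\mu I_N)\cdot\det(X_N-\nu I_N)$ are integrable. Let $(\xi_N)_{N\in\mathbb{N}}$ be a sequence of real numbers such that $\lim_{N\to\infty}\xi_N/\sqrt N=\xi$ for some $\xi\in(-2,2)$, and let $\eta\in\mathbb{C}$. Then $$\lim_{N\to\infty}\sqrt{\frac{2\pi}{N^3}}\cdot\frac1{N!}\cdot\exp(-\xi_N^2/2)\cdot f\Big(N;\xi_N+\frac{\eta}{\sqrt N},\,\xi_N-\frac{\eta}{\sqrt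 N}\Big)=\exp\Big(\frac{b-3}{2}\Big)\cdot(4-\xi^2)^{3/2}\cdot T\big(\sqrt{4-\xi^2}\cdot\eta\big),$$ where $T(z):=\frac12\Big(\frac{\sin z}{z^3}-\frac{\cos z}{z^2}\Big)$ for $z\in\mathbb{C}\setminus\{0\}$ and $T(0):=\frac16$. -/

import Mathlib

open MeasureTheory ProbabilityTheory Filter Topology

/-- The moment conditions on the entry distribution `Q`: mean `0`, variance `1`
and finite fourth moment (so that all moments up to order four exist). -/
structure HasWignerMoments (Q : Measure ℝ) : Prop where
  mean_eq_zero : ∫ x, x ∂Q = 0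
  second_moment_eq_one : ∫ x, x ^ 2 ∂Q = 1
  fourth_moment_finite : Integrable (fun x : ℝ => x ^ 4) Q

/-- `(X i j)` is an infinite symmetric array of real random variables such that the family
consisting of all `X i i / √2` and of all `X i j` with `i < j` is independent with common
distribution `Q`. (Rows and columns are numbered from `0`. Independence of the `X i i / √2`
is the same as independence of the `X i i`.) -/
structure IsWignerArray {Ω : Type*} [MeasurableSpace Ω] (P : Measure Ω) (Q : Measure ℝ)
    (X : ℕ → ℕ → Ω → ℝ) : Prop where
  measurable : ∀ i j, Measurable (X i j)
  symm : ∀ i j, X j i = X i j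
  indep : iIndepFun (fun p : {p : ℕ × ℕ // p.1 ≤ p.2} => X p.1.1 p.1.2) P
  law_diag : ∀ i, P.map (fun ω => X i i ω / √2) = Q
  law_offdiag : ∀ i j, i < j → P.map (X i j) = Q

/-- The `N × N` Wigner matrix (upper left corner of the array) at the sample point `ω`,
viewed as a complex matrix so that complex spectral parameters make sense. -/
noncomputable def wignerMatrix {Ω : Type*} (X : ℕ → ℕ → Ω → ℝ) (N : ℕ) (ω : Ω) :
    Matrix (Fin N) (Fin N) ℂ :=
  Matrix.of fun i j => ((X i j ω : ℝ) : ℂ)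

/-- The random variable `det (X_N - μ I_N) * det (X_N - ν I_N)`. -/
noncomputable def charPolyProduct {Ω : Type*} (X : ℕ → ℕ → Ω → ℝ) (N : ℕ) (μ ν : ℂ) (ω : Ω) : ℂ :=
  (wignerMatrix X N ω - μ • (1 : Matrix (Fin N) (Fin N) ℂ)).det *
    (wignerMatrix X N ω - ν • (1 : Matrix (Fin N) (Fin N) ℂ)).det

/-- The second-order correlation function of the characteristic polynomial,
`f(N; μ, ν) = 𝔼 (det (X_N - μ I_N) * det (X_N - ν I_N))`. -/
noncomputable def charPolyCorrelation {Ω : Type*} [MeasurableSpace Ω] (P : Measure Ω)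
    (X : ℕ → ℕ → Ω → ℝ) (N : ℕ) (μ ν : ℂ) : ℂ :=
  ∫ ω, charPolyProduct X N μ ν ω ∂P

open Classical in
/-- `T(z) = (sin z / z ^ 3 - cos z / z ^ 2) / 2` for `z ≠ 0`, and `T(0) = 1 / 6`. -/
noncomputable def limitT (z : ℂ) : ℂ :=
  if z = 0 then 1 / 6 else (1 / 2) * (Complex.sin z / z ^ 3 - Complex.cos z / z ^ 2)

/-! Bordering a symmetric matrix `M` by one row writes the new determinant as (X_nn - μ) det M - ∑
X_nk X_nl adj(M)_kl (`det_border`), where `M` is independent of the new row. An off-diagonal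
cofactor expands in the same way along two rows. Second moments therefore close up on five
quantities: E[det · det], E[det · tr adj] in both orders, E[tr adj · tr adj], and E[∑ adj_ij ·
adj_ij], with spectral parameter μ in the first factor and ν in the second. Only entry moments up to
order four enter. The fourth moment b multiplies only the squared diagonal cofactors, and these are
smaller determinants. After division by n! one obtains a linear recursion (`IsMinorRecursion`,
`IsWignerArray.minorCor_eq`) whose only n-dependence is a factor n + 1. It becomes a first-order
linear differential equation for Φ(x) = ∑ f(n; μ, ν) xⁿ / n!, solved explicitly by `genFun`
(`isMinorRecursion_taylorCoef`).

For the asymptotics, Cauchy's formula is used on the circle of radius exp(-1/N), with x = exp(-z/N)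
and z = 1 - iu. The singularity (1 - x)^(-5/2) at x = 1 dominates: at this scale N(1 - x) tends to
z, while the weaker singularity (1 + x)^(-1/2) at -1 is controlled by the crude bounds behind
`contourExponent_re_le`. Dominated convergence (`tendsto_taylorCoef_genFun`) leaves a constant times
the integral of z^(-5/2) exp(az - η²/z), where a = 1 - ξ²/4 > 0. Expanding exp(-η²/z) and applying
Hankel's formula `integral_exp_neg_mul_log` to each term gives a power series in η², and the
duplication formula identifies it with `limitT` (`integral_limitExponent`). -/

namespace Matrix

/-! ### Determinant and cofactors of a bordered matrix. -/

/-- The matrix obtained from `M` by adding a column `u`, a row `v` and a corner entry `a`. -/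
def border {κ R : Type*} (M : Matrix κ κ R) (u v : κ → R) (a : R) :
    Matrix (Option κ) (Option κ) R :=
  of fun i j => i.elim (j.elim a v) fun i => j.elim (u i) (M i)

section border

variable {κ R : Type*}

@[simp] lemma border_none_none (M : Matrix κ κ R) (u v : κ → R) (a : R) :
    border M u v a none none = a := rfl

@[simp] lemma border_none_some (M : Matrix κ κ R) (u v : κ → R) (a : R) (j : κ) :
    border M u v a none (some j) = v j := rfl

@[simp] lemma border_some_none (M : Matrix κ κ R) (u v : κ → R) (a : R) (i : κ) :
    border M u v a (some i) none = u i := rfl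

@[simp] lemma border_some_some (M : Matrix κ κ R) (u v : κ → R) (a : R) (i j : κ) :
    border M u v a (some i) (some j) = M i j := rfl

lemma transpose_border (M : Matrix κ κ R) (u v : κ → R) (a : R) :
    (border M u v a)ᵀ = border Mᵀ v u a := by
  ext (_ | i) (_ | j) <;> rfl

variable [Fintype κ] [DecidableEq κ] [CommRing R]

lemma det_border_zero_left (M : Matrix κ κ R) (v : κ → R) (a : R) :
    (border M 0 v a).det = M.det * a := by
  have h : (border M 0 v a).submatrix (Equiv.optionEquivSumPUnit.{0} κ).symm
      (Equiv.optionEquivSumPUnit.{0} κ).symm =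
      fromBlocks M 0 (of fun (_ : PUnit.{1}) j => v j) (of fun (_ _ : PUnit.{1}) => a) := by
    ext (i | i) (j | j) <;> simp
  rw [← det_submatrix_equiv_self (Equiv.optionEquivSumPUnit.{0} κ).symm, h, det_fromBlocks_zero₁₂]
  simp

lemma det_border_zero_right (M : Matrix κ κ R) (u : κ → R) (a : R) :
    (border M u 0 a).det = M.det * a := by
  rw [← det_transpose, transpose_border, det_border_zero_left, det_transpose]

/-- Since M · adj(M) u = det(M) u, a column operation with multiplier det M clears the border
column. Its price is the extra factor det M on both sides. -/
lemma det_mul_det_border (M : Matrix κ κ R) (u v : κ → R) (a : R) :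
    M.det * (border M u v a).det = M.det * (M.det * a - v ⬝ᵥ (M.adjugate *ᵥ u)) := by
  have h : border M u v a * border 1 (-(M.adjugate *ᵥ u)) 0 M.det =
      border M 0 v (M.det * a - v ⬝ᵥ (M.adjugate *ᵥ u)) := by
    ext (_ | i) (_ | j)
    · simp [mul_apply, dotProduct]
      ring
    · simp [mul_apply, one_apply]
    · have := congrFun (congrArg (fun A => A *ᵥ u) (mul_adjugate M)) i
      simp only [← mulVec_mulVec, smul_mulVec, one_mulVec, Pi.smul_apply, smul_eq_mul] at this
      simp only [mul_apply, Fintype.sum_option, border_some_none, border_some_some,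
        border_none_none, Pi.neg_apply, mul_neg, Finset.sum_neg_distrib, Pi.zero_apply]
      rw [show ∑ x, M i x * (M.adjugate *ᵥ u) x = (M *ᵥ (M.adjugate *ᵥ u)) i from rfl, this]
      ring
    · simp [mul_apply, one_apply]
  have := congrArg det h
  rw [det_mul, det_border_zero_right, det_border_zero_left] at this
  simpa [mul_comm] using this

/-- Cauchy's expansion of a bordered determinant. -/
lemma det_border (M : Matrix κ κ R) (u v : κ → R) (a : R) :
    (border M u v a).det = M.det * a - v ⬝ᵥ (M.adjugate *ᵥ u) := by
  -- To cancel det M over any commutative ring, pass to X + M: its determinant is monic, hence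
  -- regular. Setting X = 0 afterwards recovers M.
  open Polynomial in
  have key := det_mul_det_border (charmatrix (-M)) (fun i => C (u i)) (fun i => C (v i)) (C a)
  have hreg := ((-M).charpoly_monic).isRegular.left
  have h := congrArg (Polynomial.evalRingHom 0) (hreg key)
  have hM : (Polynomial.evalRingHom (0 : R)).mapMatrix (charmatrix (-M)) = M := by
    ext i j
    by_cases hij : i = j
    · subst hij; simp
    · simp [hij]
  have hN : (Polynomial.evalRingHom (0 : R)).mapMatrix (border (charmatrix (-M))
      (fun i => Polynomial.C (u i)) (fun i => Polynomial.C (v i)) (Polynomial.C a)) =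
      border M u v a := by
    ext (_ | i) (_ | j)
    · simp
    · simp
    · simp
    · simpa using congrFun (congrFun hM i) j
  rw [RingHom.map_det, hN] at h
  rw [h]
  simp only [map_sub, map_mul, RingHom.map_det, hM, dotProduct, mulVec, map_sum]
  have hadj : ∀ i j, (Polynomial.evalRingHom (0 : R)) ((charmatrix (-M)).adjugate i j) =
      M.adjugate i j := by
    intro i j
    have := RingHom.map_adjugate (Polynomial.evalRingHom (0 : R)) (charmatrix (-M))
    rw [hM] at this
    rw [← this]
    rfl
  simp [hadj]

lemma adjugate_border_none_none (M : Matrix κ κ R) (u v : κ → R) (a : R) :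
    (border M u v a).adjugate none none = M.det := by
  have h : (border M u v a).updateRow none (Pi.single none 1) = border M u 0 1 := by
    ext (_ | i) (_ | j) <;> simp [updateRow_apply]
  rw [adjugate_apply, h, det_border_zero_right, mul_one]

/-- Replacing row `some i` by a unit vector gives a bordered matrix whose inner block has a zero row
i. That block has determinant zero, and only column i of its adjugate survives in `det_border`. -/
lemma adjugate_border_none_some (M : Matrix κ κ R) (u v : κ → R) (a : R) (i : κ) :
    (border M u v a).adjugate none (some i) = -∑ k, v k * M.adjugate k i := by
  have h : (border M u v a).updateRow (some i) (Pi.single none 1) =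
      border (M.updateRow i 0) (Function.update u i 1) v a := by
    ext (_ | k) (_ | j) <;> simp [updateRow_apply, Function.update_apply]
  have h0 : (M.updateRow i 0).det = 0 := det_eq_zero_of_row_eq_zero i (by simp)
  have h1 : ∀ k l, (M.updateRow i 0).adjugate k l = if l = i then M.adjugate k i else 0 := by
    intro k l
    rw [adjugate_apply]
    split_ifs with hl
    · subst hl
      rw [adjugate_apply, updateRow_idem]
    · exact det_eq_zero_of_row_eq_zero i (by simp [updateRow_apply, Ne.symm hl])
  rw [adjugate_apply, h, det_border, h0]
  simp only [dotProduct, mulVec, h1, Function.update_apply, zero_mul, zero_sub, ite_mul, mul_ite,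
    mul_one]
  congr 1
  refine Finset.sum_congr rfl fun k _ => ?_
  congr 1
  rw [Finset.sum_eq_single i] <;> simp +contextual

lemma adjugate_border_some_none (M : Matrix κ κ R) (u v : κ → R) (a : R) (i : κ) :
    (border M u v a).adjugate (some i) none = -∑ k, M.adjugate i k * u k := by
  have := adjugate_border_none_some Mᵀ v u a i
  rw [← transpose_border, ← adjugate_transpose, ← adjugate_transpose] at this
  simpa [mul_comm] using this

end border

end Matrix

/-! ### Independence of groups of entries, and mixed moments. -/

/-- The unordered pair `{i, j}` as an index of the independent family of matrix entries. -/
def pairIdx (i j : ℕ) : {p : ℕ × ℕ // p.1 ≤ p.2} := ⟨(min i j, max i j), min_le_max⟩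

lemma pairIdx_eq_pairIdx {i j k l : ℕ} :
    pairIdx i j = pairIdx k l ↔ (i = k ∧ j = l) ∨ (i = l ∧ j = k) := by
  simp only [pairIdx, Subtype.ext_iff, Prod.ext_iff]
  omega

/-- The σ-algebra generated by the matrix entries with index in `S`. -/
abbrev entrySigma {Ω : Type*} (X : ℕ → ℕ → Ω → ℝ) (S : Set {p : ℕ × ℕ // p.1 ≤ p.2}) :
    MeasurableSpace Ω :=
  ⨆ q ∈ S, MeasurableSpace.comap (X q.1.1 q.1.2) inferInstance

lemma entrySigma_mono {Ω : Type*} {X : ℕ → ℕ → Ω → ℝ} {S T : Set {p : ℕ × ℕ // p.1 ≤ p.2}} (h : S ⊆ T) :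
    entrySigma X S ≤ entrySigma X T :=
  biSup_mono h

section Independence

variable {Ω : Type*} [MeasurableSpace Ω] {P : Measure Ω} {Q : Measure ℝ} {X : ℕ → ℕ → Ω → ℝ}

lemma IsWignerArray.eq_pairIdx (hX : IsWignerArray P Q X) (i j : ℕ) :
    X i j = X (pairIdx i j).1.1 (pairIdx i j).1.2 := by
  rcases le_total i j with h | h
  · simp [pairIdx, h]
  · simp [pairIdx, h, hX.symm i j]

lemma IsWignerArray.entrySigma_le (hX : IsWignerArray P Q X)
    (S : Set {p : ℕ × ℕ // p.1 ≤ p.2}) : entrySigma X S ≤ ‹MeasurableSpace Ω› :=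
  iSup₂_le fun _ _ => (hX.measurable _ _).comap_le

lemma IsWignerArray.measurable_entry (hX : IsWignerArray P Q X)
    {S : Set {p : ℕ × ℕ // p.1 ≤ p.2}} {i j : ℕ} (h : pairIdx i j ∈ S) :
    Measurable[entrySigma X S] fun ω => (X i j ω : ℂ) := by
  have h1 : Measurable[entrySigma X S] (X i j) := by
    rw [hX.eq_pairIdx i j, measurable_iff_comap_le]
    exact le_iSup₂_of_le (pairIdx i j) h le_rfl
  exact Complex.measurable_ofReal.comp h1

lemma IsWignerArray.indepFun (hX : IsWignerArray P Q X)
    {S T : Set {p : ℕ × ℕ // p.1 ≤ p.2}} (hST : Disjoint S T) {u v : Ω → ℂ}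
    (hu : Measurable[entrySigma X S] u) (hv : Measurable[entrySigma X T] v) :
    IndepFun u v P := by
  rw [IndepFun_iff_Indep]
  have h := indep_iSup_of_disjoint (fun q => (hX.measurable q.1.1 q.1.2).comap_le)
    hX.indep.iIndep hST
  exact indep_of_indep_of_le_left (indep_of_indep_of_le_right h hv.comap_le) hu.comap_le

lemma IsWignerArray.integral_mul (hX : IsWignerArray P Q X)
    {S T : Set {p : ℕ × ℕ // p.1 ≤ p.2}} (hST : Disjoint S T) {u v : Ω → ℂ}
    (hu : Measurable[entrySigma X S] u) (hv : Measurable[entrySigma X T] v) :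
    ∫ ω, u ω * v ω ∂P = (∫ ω, u ω ∂P) * ∫ ω, v ω ∂P :=
  (hX.indepFun hST hu hv).integral_fun_mul_eq_mul_integral
    (hu.mono (hX.entrySigma_le S) le_rfl).aestronglyMeasurable
    (hv.mono (hX.entrySigma_le T) le_rfl).aestronglyMeasurable

/-- Independence takes the place of Hölder's inequality: the squared norms are independent and
integrable. No integrability is lost, so four moments suffice for matrices of every size. -/
lemma IsWignerArray.memLp_two_mul (hX : IsWignerArray P Q X)
    {S T : Set {p : ℕ × ℕ // p.1 ≤ p.2}} (hST : Disjoint S T) {u v : Ω → ℂ}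
    (hu : Measurable[entrySigma X S] u) (hv : Measurable[entrySigma X T] v)
    (hu2 : MemLp u 2 P) (hv2 : MemLp v 2 P) : MemLp (fun ω => u ω * v ω) 2 P := by
  have hind : IndepFun (fun ω => ‖u ω‖ ^ 2) (fun ω => ‖v ω‖ ^ 2) P :=
    (hX.indepFun hST hu hv).comp (φ := fun z => ‖z‖ ^ 2) (ψ := fun z => ‖z‖ ^ 2)
      (by fun_prop) (by fun_prop)
  rw [memLp_two_iff_integrable_sq_norm (hu2.1.fun_mul hv2.1)]
  have h := hind.integrable_mul ((memLp_two_iff_integrable_sq_norm hu2.1).1 hu2)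
    ((memLp_two_iff_integrable_sq_norm hv2.1).1 hv2)
  refine h.congr (Eventually.of_forall fun ω => ?_)
  simp [mul_pow]

/-- Expectation of a product of two sums whose coefficients are independent of their terms. -/
lemma IsWignerArray.integral_sum_mul_sum (hX : IsWignerArray P Q X)
    {S T : Set {p : ℕ × ℕ // p.1 ≤ p.2}} (hST : Disjoint S T)
    {J K : Type*} [Fintype J] [Fintype K] {s V : J → Ω → ℂ} {t W : K → Ω → ℂ}
    (hs : ∀ p, Measurable[entrySigma X S] (s p)) (ht : ∀ p, Measurable[entrySigma X S] (t p))
    (hV : ∀ p, Measurable[entrySigma X T] (V p)) (hW : ∀ p, Measurable[entrySigma X T] (W p))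
    (hs2 : ∀ p, MemLp (s p) 2 P) (ht2 : ∀ p, MemLp (t p) 2 P)
    (hV2 : ∀ p, MemLp (V p) 2 P) (hW2 : ∀ p, MemLp (W p) 2 P) :
    ∫ ω, (∑ p, s p ω * V p ω) * (∑ q, t q ω * W q ω) ∂P =
      ∑ p, ∑ q, (∫ ω, s p ω * t q ω ∂P) * ∫ ω, V p ω * W q ω ∂P := by
  have hst : ∀ p q, Measurable[entrySigma X S] fun ω => s p ω * t q ω :=
    fun p q => (hs p).mul (ht q)
  have hVW : ∀ p q, Measurable[entrySigma X T] fun ω => V p ω * W q ω :=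
    fun p q => (hV p).mul (hW q)
  have hint : ∀ p q, Integrable (fun ω => (s p ω * t q ω) * (V p ω * W q ω)) P := fun p q =>
    (hX.indepFun hST (hst p q) (hVW p q)).integrable_mul
      ((hs2 p).integrable_mul (ht2 q)) ((hV2 p).integrable_mul (hW2 q))
  calc ∫ ω, (∑ p, s p ω * V p ω) * (∑ q, t q ω * W q ω) ∂P
      = ∫ ω, ∑ p, ∑ q, (s p ω * t q ω) * (V p ω * W q ω) ∂P := by
        congr with ω
        rw [Finset.sum_mul_sum]
        refine Finset.sum_congr rfl fun p _ => Finset.sum_congr rfl fun q _ => by ring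
    _ = _ := by
        rw [integral_finsetSum _ fun p _ => integrable_finsetSum _ fun q _ => hint p q]
        refine Finset.sum_congr rfl fun p _ => ?_
        rw [integral_finsetSum _ fun q _ => hint p q]
        exact Finset.sum_congr rfl fun q _ => hX.integral_mul hST (hst p q) (hVW p q)

/-! ### Moments of the entries -/

lemma memLp_four_id (hQ : HasWignerMoments Q) : MemLp (fun x : ℝ => x) 4 Q := by
  have h := (integrable_norm_rpow_iff (μ := Q) (f := fun x : ℝ => x) (p := 4)
    aestronglyMeasurable_id (by norm_num) (by norm_num)).1
  apply h
  refine hQ.fourth_moment_finite.congr (Eventually.of_forall fun x => ?_)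
  have : (4 : ENNReal).toReal = (4 : ℕ) := by norm_num
  simp only [this, Real.rpow_natCast, Real.norm_eq_abs]
  rw [Even.pow_abs (by decide)]

lemma IsWignerArray.memLp_four (hX : IsWignerArray P Q X) (hQ : HasWignerMoments Q) (i j : ℕ) :
    MemLp (fun ω => (X i j ω : ℂ)) 4 P := by
  have key : ∀ i j, i < j → MemLp (X i j) 4 P := by
    intro i j hij
    have h := memLp_four_id hQ
    rw [← hX.law_offdiag i j hij] at h
    exact (memLp_map_measure_iff h.1 (hX.measurable i j).aemeasurable).1 h
  have : MemLp (X i j) 4 P := by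
    rcases lt_trichotomy i j with hij | rfl | hij
    · exact key i j hij
    · have h := memLp_four_id hQ
      rw [← hX.law_diag i] at h
      have h' := (memLp_map_measure_iff h.1
        ((hX.measurable i i).div_const _).aemeasurable).1 h
      refine (h'.const_mul (√2)).ae_eq (Eventually.of_forall fun ω => ?_)
      have : √2 ≠ 0 := by positivity
      simp only [Function.comp]
      field_simp
    · rw [hX.symm j i]
      exact key j i hij
  exact this.ofReal

/-- Products of two entries, possibly equal, lie in L² because the entries lie in L⁴. -/
instance : ENNReal.HolderTriple 4 4 2 := by
  constructor
  rw [← two_mul, show (4 : ENNReal) = 2 * 2 by norm_num,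
    ENNReal.mul_inv (by norm_num) (by norm_num), ← mul_assoc,
    ENNReal.mul_inv_cancel (by norm_num) (by norm_num), one_mul]

lemma IsWignerArray.memLp_two_mul_entries (hX : IsWignerArray P Q X) (hQ : HasWignerMoments Q)
    (i j k l : ℕ) : MemLp (fun ω => (X i j ω : ℂ) * (X k l ω : ℂ)) 2 P :=
  MemLp.mul' (hX.memLp_four hQ k l) (hX.memLp_four hQ i j)

lemma IsWignerArray.integral_comp_offdiag (hX : IsWignerArray P Q X) {i j : ℕ} (hij : i ≠ j)
    {g : ℝ → ℂ} (hg : Measurable g) : ∫ ω, g (X i j ω) ∂P = ∫ x, g x ∂Q := by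
  rcases lt_or_gt_of_ne hij with h | h
  · rw [← hX.law_offdiag i j h, integral_map (hX.measurable i j).aemeasurable
      hg.aestronglyMeasurable]
  · rw [hX.symm j i, ← hX.law_offdiag j i h, integral_map (hX.measurable j i).aemeasurable
      hg.aestronglyMeasurable]

lemma IsWignerArray.integral_entry (hX : IsWignerArray P Q X) (hQ : HasWignerMoments Q)
    (i j : ℕ) : ∫ ω, (X i j ω : ℂ) ∂P = 0 := by
  rcases eq_or_ne i j with rfl | hij
  · have h : ∫ ω, ((X i i ω / √2 : ℝ) : ℂ) ∂P = ∫ x, (x : ℂ) ∂Q := by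
      rw [← hX.law_diag i, integral_map ((hX.measurable i i).div_const _).aemeasurable
        Complex.measurable_ofReal.aestronglyMeasurable]
    rw [integral_complex_ofReal, integral_complex_ofReal, hQ.mean_eq_zero, integral_div] at h
    rw [integral_complex_ofReal]
    have h2 : √2 ≠ 0 := by positivity
    simpa [h2] using h
  · rw [hX.integral_comp_offdiag hij Complex.measurable_ofReal, integral_complex_ofReal,
      hQ.mean_eq_zero, Complex.ofReal_zero]

lemma IsWignerArray.integral_entry_sq (hX : IsWignerArray P Q X) (hQ : HasWignerMoments Q)
    (i j : ℕ) : ∫ ω, (X i j ω : ℂ) * (X i j ω : ℂ) ∂P = if i = j then 2 else 1 := by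
  have hg : Measurable fun x : ℝ => (x : ℂ) * (x : ℂ) := by fun_prop
  have hQ2 : ∫ x, (x : ℂ) * (x : ℂ) ∂Q = 1 := by
    rw [← Complex.ofReal_one, ← hQ.second_moment_eq_one, ← integral_complex_ofReal]
    congr with x
    push_cast
    ring
  rcases eq_or_ne i j with rfl | hij
  · have h : ∫ ω, ((X i i ω / √2 : ℝ) : ℂ) * ((X i i ω / √2 : ℝ) : ℂ) ∂P = 1 := by
      rw [← hQ2, ← hX.law_diag i, integral_map ((hX.measurable i i).div_const _).aemeasurable
        hg.aestronglyMeasurable]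
    have h2 : ∀ ω, ((X i i ω / √2 : ℝ) : ℂ) * ((X i i ω / √2 : ℝ) : ℂ) =
        (X i i ω : ℂ) * (X i i ω : ℂ) / 2 := by
      intro ω
      rw [← Complex.ofReal_mul, ← Complex.ofReal_mul, div_mul_div_comm,
        Real.mul_self_sqrt (by norm_num)]
      push_cast
      rfl
    simp only [h2] at h
    rw [integral_div] at h
    rw [if_pos rfl]
    linear_combination 2 * h
  · rw [hX.integral_comp_offdiag hij hg, hQ2, if_neg hij]

lemma IsWignerArray.integral_entry_four (hX : IsWignerArray P Q X) {i j : ℕ} (hij : i ≠ j) :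
    ∫ ω, (X i j ω : ℂ) * ((X i j ω : ℂ) * ((X i j ω : ℂ) * (X i j ω : ℂ))) ∂P =
      ((∫ x, x ^ 4 ∂Q : ℝ) : ℂ) := by
  have hg : Measurable fun x : ℝ => (x : ℂ) * ((x : ℂ) * ((x : ℂ) * (x : ℂ))) := by fun_prop
  rw [hX.integral_comp_offdiag hij hg, ← integral_complex_ofReal]
  congr with x
  push_cast
  ring

/-- An entry which is independent of the remaining factors contributes a factor zero. -/
lemma IsWignerArray.integral_entry_mul (hX : IsWignerArray P Q X) (hQ : HasWignerMoments Q)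
    {i j : ℕ} {u : Ω → ℂ} (hu : Measurable[entrySigma X {pairIdx i j}ᶜ] u) :
    ∫ ω, (X i j ω : ℂ) * u ω ∂P = 0 := by
  rw [hX.integral_mul (S := {pairIdx i j}) disjoint_compl_right
    (hX.measurable_entry (Set.mem_singleton _)) hu, hX.integral_entry hQ, zero_mul]

lemma IsWignerArray.integral_entry_sq_mul (hX : IsWignerArray P Q X) (hQ : HasWignerMoments Q)
    {i j : ℕ} {u : Ω → ℂ} (hu : Measurable[entrySigma X {pairIdx i j}ᶜ] u) :
    ∫ ω, (X i j ω : ℂ) * ((X i j ω : ℂ) * u ω) ∂P = (if i = j then 2 else 1) * ∫ ω, u ω ∂P := by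
  have hm := hX.measurable_entry (Set.mem_singleton (pairIdx i j))
  simp only [← mul_assoc]
  rw [hX.integral_mul (S := {pairIdx i j}) disjoint_compl_right (hm.fun_mul hm) hu,
    hX.integral_entry_sq hQ]

lemma IsWignerArray.integral_mul_entries (hX : IsWignerArray P Q X) (hQ : HasWignerMoments Q)
    {i j k l : ℕ} (hij : i ≠ j) :
    ∫ ω, (X i j ω : ℂ) * (X k l ω : ℂ) ∂P =
      if pairIdx i j = pairIdx k l then 1 else 0 := by
  split_ifs with h
  · have : X k l = X i j := by rw [hX.eq_pairIdx k l, ← h, ← hX.eq_pairIdx]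
    simp only [this, hX.integral_entry_sq hQ, if_neg hij]
  · exact hX.integral_entry_mul hQ (hX.measurable_entry (Ne.symm h))

/-- Mixed moments of order four of off-diagonal entries. -/
lemma IsWignerArray.integral_four_entries [IsProbabilityMeasure P] (hX : IsWignerArray P Q X)
    (hQ : HasWignerMoments Q)
    {i₁ j₁ i₂ j₂ i₃ j₃ i₄ j₄ : ℕ} (h₁ : i₁ ≠ j₁) (h₂ : i₂ ≠ j₂) (h₃ : i₃ ≠ j₃) :
    ∫ ω, (X i₁ j₁ ω : ℂ) * ((X i₂ j₂ ω : ℂ) * ((X i₃ j₃ ω : ℂ) * (X i₄ j₄ ω : ℂ))) ∂P =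
      (if pairIdx i₁ j₁ = pairIdx i₂ j₂ ∧ pairIdx i₃ j₃ = pairIdx i₄ j₄ then 1 else 0) +
      (if pairIdx i₁ j₁ = pairIdx i₃ j₃ ∧ pairIdx i₂ j₂ = pairIdx i₄ j₄ then 1 else 0) +
      (if pairIdx i₁ j₁ = pairIdx i₄ j₄ ∧ pairIdx i₂ j₂ = pairIdx i₃ j₃ then 1 else 0) +
      (if pairIdx i₁ j₁ = pairIdx i₂ j₂ ∧ pairIdx i₁ j₁ = pairIdx i₃ j₃ ∧
        pairIdx i₁ j₁ = pairIdx i₄ j₄ then ((∫ x, x ^ 4 ∂Q : ℝ) : ℂ) - 3 else 0) := by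
  have hc : ∀ {i j k l : ℕ}, pairIdx i j = pairIdx k l → X i j = X k l := by
    intro i j k l h
    rw [hX.eq_pairIdx i j, h, ← hX.eq_pairIdx]
  have hm : ∀ {i j k l : ℕ}, pairIdx k l ≠ pairIdx i j →
      Measurable[entrySigma X {pairIdx i j}ᶜ] fun ω => (X k l ω : ℂ) :=
    fun h => hX.measurable_entry h
  -- the case of a coinciding first pair of factors
  have hpair : ∀ {i j k l m n : ℕ}, i ≠ j → k ≠ l →
      ∫ ω, (X i j ω : ℂ) * ((X i j ω : ℂ) * ((X k l ω : ℂ) * (X m n ω : ℂ))) ∂P =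
        if pairIdx i j = pairIdx k l ∧ pairIdx i j = pairIdx m n
          then ((∫ x, x ^ 4 ∂Q : ℝ) : ℂ)
        else if pairIdx k l = pairIdx m n then 1 else 0 := by
    intro i j k l m n hij hkl
    by_cases hk : pairIdx i j = pairIdx k l <;> by_cases hn : pairIdx i j = pairIdx m n
    · simp only [← hc hk, ← hc hn, hX.integral_entry_four hij, hk, hk ▸ hn, and_self, if_true]
    · rw [if_neg (by tauto), if_neg (by rwa [← hk]), ← hc hk]
      have h := hX.integral_entry_mul hQ (i := m) (j := n)
        (((hm (i := m) (j := n) hn).mul (hm hn)).mul (hm hn))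
      rw [← h]
      congr with ω
      simp only [Pi.mul_apply]
      ring
    · rw [if_neg (by tauto), if_neg (by rw [← hn]; exact Ne.symm hk), ← hc hn]
      have h := hX.integral_entry_mul hQ (i := k) (j := l)
        (((hm (i := k) (j := l) hk).mul (hm hk)).mul (hm hk))
      rw [← h]
      congr with ω
      simp only [Pi.mul_apply]
      ring
    · rw [if_neg (by tauto), hX.integral_entry_sq_mul hQ ((hm (Ne.symm hk)).fun_mul (hm (Ne.symm hn))),
        if_neg hij, one_mul]
      exact hX.integral_mul_entries hQ hkl
  by_cases h12 : pairIdx i₁ j₁ = pairIdx i₂ j₂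
  · rw [← hc h12, hpair h₁ h₃, ← h12]
    by_cases h13 : pairIdx i₁ j₁ = pairIdx i₃ j₃ <;> by_cases h14 : pairIdx i₁ j₁ = pairIdx i₄ j₄
    -- All four entries coincide: each of the three pairings already contributes 1, so the
    -- correction has to be b - 3.
    · simp only [h13, h13 ▸ h14, and_self, if_true]
      ring
    · simp [h13, h13 ▸ h14]
    · have : pairIdx i₃ j₃ ≠ pairIdx i₄ j₄ := h14 ▸ Ne.symm h13
      simp [h13, this]
    · simp [h13, h14]
  by_cases h13 : pairIdx i₁ j₁ = pairIdx i₃ j₃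
  · have h := hpair (m := i₄) (n := j₄) h₁ h₂
    rw [if_neg (by tauto)] at h
    have h32 : pairIdx i₃ j₃ ≠ pairIdx i₂ j₂ := h13 ▸ h12
    simp only [← hc h13, h12, false_and, if_false, ← h13, Ne.symm h12, and_false, add_zero,
      true_and, zero_add]
    rw [← h]
    congr with ω
    ring
  by_cases h14 : pairIdx i₁ j₁ = pairIdx i₄ j₄
  · have h := hpair (m := i₃) (n := j₃) h₁ h₂
    rw [if_neg (by tauto)] at h
    simp only [← hc h14, h12, false_and, if_false, ← h14, h13, and_false, add_zero,
      true_and, zero_add]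
    rw [← h]
    congr with ω
    ring
  · simp only [h12, h13, h14, false_and, if_false, add_zero]
    exact hX.integral_entry_mul hQ
      ((hm (Ne.symm h12)).mul ((hm (Ne.symm h13)).mul (hm (Ne.symm h14))))

end Independence

open Matrix

set_option linter.unusedSectionVars false

/-! ### Submatrices indexed by a map into ℕ, and the entries they use. -/

/-- The matrix `X_e - μ I`, where `X_e` has the entries `X (e i) (e j)`. -/
def charMat {Ω ι : Type*} [DecidableEq ι] (X : ℕ → ℕ → Ω → ℝ) (e : ι → ℕ) (μ : ℂ) (ω : Ω) :
    Matrix ι ι ℂ :=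
  of fun i j => (X (e i) (e j) ω : ℂ) - if i = j then μ else 0

/-- The indices of the entries used by the matrix `charMat X e μ`. -/
def innerPairs {ι : Type*} (e : ι → ℕ) : Set {p : ℕ × ℕ // p.1 ≤ p.2} :=
  {q | q.1.1 ∈ Set.range e ∧ q.1.2 ∈ Set.range e}

lemma pairIdx_mem_innerPairs {ι : Type*} (e : ι → ℕ) (i j : ι) :
    pairIdx (e i) (e j) ∈ innerPairs e := by
  rcases le_total (e i) (e j) with h | h <;> simp [innerPairs, pairIdx, h]

lemma pairIdx_mem_compl_innerPairs {ι : Type*} {e : ι → ℕ} {n : ℕ} (hn : n ∉ Set.range e)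
    (k : ℕ) : pairIdx n k ∈ (innerPairs e)ᶜ := by
  rintro ⟨h1, h2⟩
  rcases le_total n k with h | h <;> simp_all [pairIdx]

/-- The indices of the entries which connect `n` to itself or to the range of `e`. -/
def rowPairs {ι : Type*} (n : ℕ) (e : ι → ℕ) : Set {p : ℕ × ℕ // p.1 ≤ p.2} :=
  {q | ∃ k, (k = n ∨ k ∈ Set.range e) ∧ pairIdx n k = q}

lemma rowPairs_subset {ι : Type*} {e : ι → ℕ} {n : ℕ} (hn : n ∉ Set.range e) :
    rowPairs n e ⊆ (innerPairs e)ᶜ := by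
  rintro _ ⟨k, -, rfl⟩
  exact pairIdx_mem_compl_innerPairs hn k

/-- The only candidate for a common entry joins m and n, and it belongs to neither set. -/
lemma disjoint_rowPairs {ι : Type*} {e : ι → ℕ} {m n : ℕ} (hm : m ∉ Set.range e) (hmn : m ≠ n) :
    Disjoint (rowPairs m e) (rowPairs n e) := by
  rw [Set.disjoint_left]
  rintro _ ⟨k, -, rfl⟩ ⟨l, hl, h⟩
  rcases pairIdx_eq_pairIdx.1 h with ⟨h1, -⟩ | ⟨h1, h2⟩
  · exact hmn h1.symm
  · rcases hl with hl | hl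
    · exact hmn (h2 ▸ hl)
    · exact hm (h2 ▸ hl)

lemma pairIdx_left_inj {n k l : ℕ} : pairIdx n k = pairIdx n l ↔ k = l := by
  rw [pairIdx_eq_pairIdx]
  omega

section CharMat

variable {Ω : Type*} {X : ℕ → ℕ → Ω → ℝ}

/-- Reindexing moves any chosen index to `none`, so expansions are needed only for index types
`Option κ`. -/
lemma charMat_comp_equiv {ι κ : Type*} [DecidableEq ι] [DecidableEq κ] (e : ι → ℕ) (φ : κ ≃ ι)
    (μ : ℂ) (ω : Ω) : charMat X (e ∘ φ) μ ω = (charMat X e μ ω).submatrix φ φ := by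
  ext i j
  simp [charMat]

variable {ι : Type*} [Fintype ι] [DecidableEq ι]

lemma det_charMat_comp_equiv {κ : Type*} [Fintype κ] [DecidableEq κ] (e : ι → ℕ) (φ : κ ≃ ι)
    (μ : ℂ) (ω : Ω) : (charMat X (e ∘ φ) μ ω).det = (charMat X e μ ω).det := by
  rw [charMat_comp_equiv, det_submatrix_equiv_self]

lemma adjugate_charMat_comp_equiv {κ : Type*} [Fintype κ] [DecidableEq κ] (e : ι → ℕ) (φ : κ ≃ ι)
    (μ : ℂ) (ω : Ω) (i j : κ) :
    (charMat X (e ∘ φ) μ ω).adjugate i j = (charMat X e μ ω).adjugate (φ i) (φ j) := by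
  rw [charMat_comp_equiv, adjugate_submatrix_equiv_self, submatrix_apply]

end CharMat

/-! ### Expansion of determinants and cofactors, and their second moments. -/

section Recursion

/-- The coefficients in the expansion of `det (X_e - μ)` along row and column `n`. -/
def detCoef {Ω κ : Type*} (X : ℕ → ℕ → Ω → ℝ) (n : ℕ) (e : κ → ℕ) (μ : ℂ) :
    Option (κ × κ) → Ω → ℂ
  | none => fun ω => (X n n ω : ℂ) - μ
  | some (k, l) => fun ω => -((X n (e k) ω : ℂ) * (X n (e l) ω : ℂ))

/-- The coefficients in the expansion of the `(m, n)` cofactor of `X_e - μ` along rows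
and columns `m` and `n`. -/
def adjCoef {Ω κ : Type*} (X : ℕ → ℕ → Ω → ℝ) (m n : ℕ) (e : κ → ℕ) :
    Option (κ × κ) → Ω → ℂ
  | none => fun ω => -((X m n ω : ℂ))
  | some (k, l) => fun ω => (X m (e k) ω : ℂ) * (X n (e l) ω : ℂ)

/-- The determinant and the cofactors of `X_e - μ`. -/
def minorVec {Ω κ : Type*} [Fintype κ] [DecidableEq κ] (X : ℕ → ℕ → Ω → ℝ) (e : κ → ℕ) (μ : ℂ) :
    Option (κ × κ) → Ω → ℂ
  | none => fun ω => (charMat X e μ ω).det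
  | some (k, l) => fun ω => (charMat X e μ ω).adjugate k l

variable {Ω : Type*} [MeasurableSpace Ω] {P : Measure Ω} {Q : Measure ℝ} {X : ℕ → ℕ → Ω → ℝ}
variable {κ : Type*} [Fintype κ] [DecidableEq κ]

lemma IsWignerArray.charMat_transpose {ι : Type*} [DecidableEq ι] (hX : IsWignerArray P Q X)
    (e : ι → ℕ) (μ : ℂ) (ω : Ω) :
    (charMat X e μ ω)ᵀ = charMat X e μ ω := by
  ext i j
  simp [charMat, hX.symm (e i) (e j), eq_comm]

lemma IsWignerArray.adjugate_charMat_comm (hX : IsWignerArray P Q X) (e : κ → ℕ) (μ : ℂ)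
    (ω : Ω) (i j : κ) :
    (charMat X e μ ω).adjugate i j = (charMat X e μ ω).adjugate j i := by
  conv_rhs => rw [← hX.charMat_transpose, ← adjugate_transpose, transpose_apply]

lemma IsWignerArray.charMat_option {κ : Type*} [DecidableEq κ] (hX : IsWignerArray P Q X)
    (e : Option κ → ℕ) (μ : ℂ)
    (ω : Ω) : charMat X e μ ω = border (charMat X (e ∘ some) μ ω)
      (fun k => (X (e none) (e (some k)) ω : ℂ)) (fun k => (X (e none) (e (some k)) ω : ℂ))
      ((X (e none) (e none) ω : ℂ) - μ) := by
  ext (_ | i) (_ | j)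
  · simp [charMat]
  · simp [charMat]
  · simp [charMat, hX.symm (e none)]
  · simp [charMat]

lemma IsWignerArray.det_charMat_option (hX : IsWignerArray P Q X) (e : Option κ → ℕ) (μ : ℂ)
    (ω : Ω) : (charMat X e μ ω).det =
      ∑ p, detCoef X (e none) (e ∘ some) μ p ω * minorVec X (e ∘ some) μ p ω := by
  rw [hX.charMat_option, det_border, Fintype.sum_option, Fintype.sum_prod_type]
  simp only [detCoef, minorVec, dotProduct, mulVec, Finset.mul_sum, Function.comp_apply, neg_mul,
    Finset.sum_neg_distrib]
  rw [mul_comm, sub_eq_add_neg]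
  congr 2
  exact Finset.sum_congr rfl fun k _ => Finset.sum_congr rfl fun l _ => by ring

lemma IsWignerArray.adjugate_charMat_none_none (hX : IsWignerArray P Q X) (e : Option κ → ℕ)
    (μ : ℂ) (ω : Ω) :
    (charMat X e μ ω).adjugate none none = (charMat X (e ∘ some) μ ω).det := by
  rw [hX.charMat_option, adjugate_border_none_none]

/-- Swapping `none` and `some none` reduces this to the corner cofactor. Composition with
`Option.map some` omits the index `some none`. -/
lemma IsWignerArray.adjugate_charMat_some_none (hX : IsWignerArray P Q X)
    (e : Option (Option κ) → ℕ) (μ : ℂ) (ω : Ω) :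
    (charMat X e μ ω).adjugate (some none) (some none) =
      (charMat X (e ∘ Option.map some) μ ω).det := by
  have h := adjugate_charMat_comp_equiv (X := X) e (Equiv.swap none (some none)) μ ω none none
  rw [Equiv.swap_apply_left] at h
  rw [← h, hX.adjugate_charMat_none_none]
  congr 2
  funext i
  rcases i with _ | i
  · simp
  · simp [Equiv.swap_apply_of_ne_of_ne]

/-- Two borderings in succession: the cofactor is expanded along the row of `none`, then along the
column of `some none`. -/
lemma IsWignerArray.adjugate_charMat_none_some (hX : IsWignerArray P Q X)
    (e : Option (Option κ) → ℕ) (μ : ℂ) (ω : Ω) :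
    (charMat X e μ ω).adjugate none (some none) =
      ∑ p, adjCoef X (e none) (e (some none)) (e ∘ some ∘ some) p ω *
        minorVec X (e ∘ some ∘ some) μ p ω := by
  rw [hX.charMat_option, adjugate_border_none_some, Fintype.sum_option, hX.charMat_option (e ∘ some),
    adjugate_border_none_none, Fintype.sum_option, Fintype.sum_prod_type]
  simp only [adjugate_border_some_none, adjCoef, minorVec, Function.comp_apply, neg_add, mul_neg,
    Finset.sum_neg_distrib, neg_neg, Finset.mul_sum, neg_mul, Function.comp_assoc]
  congr 1
  exact Finset.sum_congr rfl fun k _ => Finset.sum_congr rfl fun l _ => by ring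

/-! ### Measurability and square integrability -/

lemma measurable_det_of_entries {Ω : Type*} {m : MeasurableSpace Ω} {A : Ω → Matrix κ κ ℂ}
    (h : ∀ i j, Measurable[m] fun ω => A ω i j) : Measurable[m] fun ω => (A ω).det := by
  simp only [det_apply]
  refine Finset.measurable_sum _ fun σ _ => ?_
  exact (Finset.measurable_prod _ fun i _ => h _ _).const_smul _

lemma IsWignerArray.measurable_charMat {κ : Type*} [DecidableEq κ] (hX : IsWignerArray P Q X)
    (e : κ → ℕ) (μ : ℂ)
    (i j : κ) : Measurable[entrySigma X (innerPairs e)] fun ω => charMat X e μ ω i j :=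
  (hX.measurable_entry (pairIdx_mem_innerPairs e i j)).sub_const _

lemma IsWignerArray.measurable_minorVec (hX : IsWignerArray P Q X) (e : κ → ℕ) (μ : ℂ)
    (p : Option (κ × κ)) : Measurable[entrySigma X (innerPairs e)] (minorVec X e μ p) := by
  rcases p with _ | ⟨k, l⟩
  · exact measurable_det_of_entries (hX.measurable_charMat e μ)
  · simp only [minorVec, adjugate_apply]
    refine measurable_det_of_entries fun i j => ?_
    simp only [updateRow_apply]
    split_ifs
    · exact measurable_const
    · exact hX.measurable_charMat e μ i j

lemma IsWignerArray.measurable_detCoef_row {κ : Type*} (hX : IsWignerArray P Q X) (e : κ → ℕ)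
    (n : ℕ) (μ : ℂ) (p : Option (κ × κ)) :
    Measurable[entrySigma X (rowPairs n e)] (detCoef X n e μ p) := by
  have h : ∀ k, Measurable[entrySigma X (rowPairs n e)] fun ω => (X n (e k) ω : ℂ) :=
    fun k => hX.measurable_entry ⟨e k, Or.inr ⟨k, rfl⟩, rfl⟩
  rcases p with _ | ⟨k, l⟩
  · exact (hX.measurable_entry (S := rowPairs n e) ⟨n, Or.inl rfl, rfl⟩).sub_const _
  · exact ((h _).fun_mul (h _)).fun_neg

lemma IsWignerArray.measurable_detCoef {κ : Type*} (hX : IsWignerArray P Q X) {e : κ → ℕ} {n : ℕ}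
    (hn : n ∉ Set.range e) (μ : ℂ) (p : Option (κ × κ)) :
    Measurable[entrySigma X (innerPairs e)ᶜ] (detCoef X n e μ p) :=
  (hX.measurable_detCoef_row e n μ p).mono (entrySigma_mono (rowPairs_subset hn)) le_rfl

lemma IsWignerArray.measurable_adjCoef {κ : Type*} (hX : IsWignerArray P Q X) {e : κ → ℕ}
    {m n : ℕ} (hm : m ∉ Set.range e) (hn : n ∉ Set.range e) (p : Option (κ × κ)) :
    Measurable[entrySigma X (innerPairs e)ᶜ] (adjCoef X m n e p) := by
  have h : ∀ {m} k, m ∉ Set.range e →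
      Measurable[entrySigma X (innerPairs e)ᶜ] fun ω => (X m k ω : ℂ) :=
    fun k hm => hX.measurable_entry (pairIdx_mem_compl_innerPairs hm k)
  rcases p with _ | ⟨k, l⟩
  · exact (h n hm).fun_neg
  · exact (h _ hm).fun_mul (h _ hn)

section

variable [IsProbabilityMeasure P]

lemma IsWignerArray.memLp_two_detCoef {κ : Type*} (hX : IsWignerArray P Q X)
    (hQ : HasWignerMoments Q)
    (n : ℕ) (e : κ → ℕ) (μ : ℂ) (p : Option (κ × κ)) : MemLp (detCoef X n e μ p) 2 P := by
  rcases p with _ | ⟨k, l⟩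
  · exact ((hX.memLp_four hQ n n).mono_exponent (by norm_num)).sub (memLp_const μ)
  · exact (hX.memLp_two_mul_entries hQ _ _ _ _).neg

lemma IsWignerArray.memLp_two_adjCoef {κ : Type*} (hX : IsWignerArray P Q X)
    (hQ : HasWignerMoments Q)
    (m n : ℕ) (e : κ → ℕ) (p : Option (κ × κ)) : MemLp (adjCoef X m n e p) 2 P := by
  rcases p with _ | ⟨k, l⟩
  · exact ((hX.memLp_four hQ m n).mono_exponent (by norm_num)).neg
  · exact hX.memLp_two_mul_entries hQ _ _ _ _

/-! ### Moments of the expansion coefficients -/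

lemma IsWignerArray.integral_diag_mul_mul (hX : IsWignerArray P Q X) (hQ : HasWignerMoments Q)
    {n a b : ℕ} (ha : a ≠ n) (hb : b ≠ n) (μ : ℂ) :
    ∫ ω, ((X n n ω : ℂ) - μ) * ((X n a ω : ℂ) * (X n b ω : ℂ)) ∂P =
      -μ * if a = b then 1 else 0 := by
  have hu : Measurable[entrySigma X {pairIdx n n}ᶜ]
      fun ω => (X n a ω : ℂ) * (X n b ω : ℂ) :=
    (hX.measurable_entry (Set.mem_compl_singleton_iff.2 fun h => ha (pairIdx_left_inj.1 h))).fun_mul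
      (hX.measurable_entry (Set.mem_compl_singleton_iff.2 fun h => hb (pairIdx_left_inj.1 h)))
  have hd : Measurable[entrySigma X {pairIdx n n}] fun ω => (X n n ω : ℂ) - μ :=
    (hX.measurable_entry (Set.mem_singleton _)).sub_const _
  rw [hX.integral_mul disjoint_compl_right hd hu, hX.integral_mul_entries hQ ha.symm,
    integral_sub ((hX.memLp_four hQ n n).integrable (by norm_num)) (integrable_const _),
    hX.integral_entry hQ]
  simp [pairIdx_left_inj]

lemma IsWignerArray.integral_detCoef_none (hX : IsWignerArray P Q X) (hQ : HasWignerMoments Q)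
    {κ : Type*} (e : κ → ℕ) (n : ℕ) (μ : ℂ) : ∫ ω, detCoef X n e μ none ω ∂P = -μ := by
  simp only [detCoef]
  rw [integral_sub ((hX.memLp_four hQ n n).integrable (by norm_num)) (integrable_const _),
    hX.integral_entry hQ]
  simp

lemma IsWignerArray.integral_detCoef_some (hX : IsWignerArray P Q X) (hQ : HasWignerMoments Q)
    {e : κ → ℕ} (he : e.Injective) {n : ℕ} (hn : n ∉ Set.range e) (μ : ℂ) (k l : κ) :
    ∫ ω, detCoef X n e μ (some (k, l)) ω ∂P = -if k = l then 1 else 0 := by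
  simp only [detCoef]
  rw [integral_neg, hX.integral_mul_entries hQ fun h => hn ⟨k, h.symm⟩]
  simp [pairIdx_left_inj, he.eq_iff]

lemma IsWignerArray.integral_detCoef_none_none (hX : IsWignerArray P Q X)
    (hQ : HasWignerMoments Q) {κ : Type*} (e : κ → ℕ) (n : ℕ) (μ ν : ℂ) :
    ∫ ω, detCoef X n e μ none ω * detCoef X n e ν none ω ∂P = 2 + μ * ν := by
  have h1 : Integrable (fun ω => (X n n ω : ℂ)) P :=
    (hX.memLp_four hQ n n).integrable (by norm_num)
  have h2 : Integrable (fun ω => (X n n ω : ℂ) * (X n n ω : ℂ)) P :=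
    (hX.memLp_two_mul_entries hQ n n n n).integrable (by norm_num)
  have h3 : ∀ ω, detCoef X n e μ none ω * detCoef X n e ν none ω =
      (X n n ω : ℂ) * (X n n ω : ℂ) - (μ + ν) * (X n n ω : ℂ) + μ * ν := by
    intro ω
    simp only [detCoef]
    ring
  simp only [h3]
  have h4 : Integrable (fun ω => (X n n ω : ℂ) * (X n n ω : ℂ) - (μ + ν) * (X n n ω : ℂ)) P :=
    h2.sub (h1.const_mul _)
  rw [integral_add h4 (integrable_const _), integral_sub h2 (h1.const_mul _), integral_const_mul, hX.integral_entry hQ,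
    hX.integral_entry_sq hQ]
  simp

lemma IsWignerArray.integral_detCoef_none_some (hX : IsWignerArray P Q X)
    (hQ : HasWignerMoments Q) {e : κ → ℕ} (he : e.Injective) {n : ℕ} (hn : n ∉ Set.range e)
    (μ ν : ℂ) (k l : κ) :
    ∫ ω, detCoef X n e μ none ω * detCoef X n e ν (some (k, l)) ω ∂P =
      if k = l then μ else 0 := by
  have h := hX.integral_diag_mul_mul hQ (a := e k) (b := e l) (fun h => hn ⟨k, h⟩)
    (fun h => hn ⟨l, h⟩) μ
  simp only [detCoef, mul_neg, integral_neg, h, he.eq_iff]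
  split_ifs <;> simp

lemma IsWignerArray.integral_detCoef_some_none (hX : IsWignerArray P Q X)
    (hQ : HasWignerMoments Q) {e : κ → ℕ} (he : e.Injective) {n : ℕ} (hn : n ∉ Set.range e)
    (μ ν : ℂ) (k l : κ) :
    ∫ ω, detCoef X n e μ (some (k, l)) ω * detCoef X n e ν none ω ∂P =
      if k = l then ν else 0 := by
  rw [← hX.integral_detCoef_none_some hQ he hn ν μ k l]
  congr with ω
  ring

lemma IsWignerArray.integral_detCoef_some_some (hX : IsWignerArray P Q X)
    (hQ : HasWignerMoments Q) {e : κ → ℕ} (he : e.Injective) {n : ℕ} (hn : n ∉ Set.range e)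
    (μ ν : ℂ) (i j k l : κ) :
    ∫ ω, detCoef X n e μ (some (i, j)) ω * detCoef X n e ν (some (k, l)) ω ∂P =
      (if i = j ∧ k = l then 1 else 0) + (if i = k ∧ j = l then 1 else 0) +
      (if i = l ∧ j = k then 1 else 0) +
      (if i = j ∧ i = k ∧ i = l then ((∫ x, x ^ 4 ∂Q : ℝ) : ℂ) - 3 else 0) := by
  have hne : ∀ i, n ≠ e i := fun i h => hn ⟨i, h.symm⟩
  have h := hX.integral_four_entries hQ (i₄ := n) (j₄ := e l) (hne i) (hne j) (hne k)
  simp only [pairIdx_left_inj, he.eq_iff] at h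
  rw [← h]
  congr with ω
  simp only [detCoef]
  ring

lemma IsWignerArray.integral_adjCoef_none_none (hX : IsWignerArray P Q X)
    (hQ : HasWignerMoments Q) {κ : Type*} (e : κ → ℕ) {m n : ℕ} (hmn : m ≠ n) :
    ∫ ω, adjCoef X m n e none ω * adjCoef X m n e none ω ∂P = 1 := by
  simp only [adjCoef, neg_mul_neg, hX.integral_entry_sq hQ, if_neg hmn]

lemma IsWignerArray.integral_adjCoef_none_some (hX : IsWignerArray P Q X)
    (hQ : HasWignerMoments Q) {e : κ → ℕ} {m n : ℕ} (hm : m ∉ Set.range e)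
    (hn : n ∉ Set.range e) (k l : κ) :
    ∫ ω, adjCoef X m n e none ω * adjCoef X m n e (some (k, l)) ω ∂P = 0 := by
  have hu : Measurable[entrySigma X {pairIdx m n}ᶜ]
      fun ω => (X m (e k) ω : ℂ) * (X n (e l) ω : ℂ) :=
    (hX.measurable_entry (Set.mem_compl_singleton_iff.2 fun h =>
      hn ⟨k, pairIdx_left_inj.1 h⟩)).fun_mul
      (hX.measurable_entry (Set.mem_compl_singleton_iff.2 fun h => by
        rcases pairIdx_eq_pairIdx.1 h with ⟨-, h⟩ | ⟨-, h⟩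
        · exact hn ⟨l, h⟩
        · exact hm ⟨l, h⟩))
  simp only [adjCoef, neg_mul, integral_neg, hX.integral_entry_mul hQ hu, neg_zero]

lemma IsWignerArray.integral_adjCoef_some_some (hX : IsWignerArray P Q X)
    (hQ : HasWignerMoments Q) {e : κ → ℕ} (he : e.Injective) {m n : ℕ} (hm : m ∉ Set.range e)
    (hn : n ∉ Set.range e) (hmn : m ≠ n) (i j k l : κ) :
    ∫ ω, adjCoef X m n e (some (i, j)) ω * adjCoef X m n e (some (k, l)) ω ∂P =
      if i = k ∧ j = l then 1 else 0 := by
  have hnem : ∀ i, m ≠ e i := fun i h => hm ⟨i, h.symm⟩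
  have hnen : ∀ i, n ≠ e i := fun i h => hn ⟨i, h.symm⟩
  have hmix : ∀ i j, pairIdx m (e i) ≠ pairIdx n (e j) := by
    intro i j h
    rcases pairIdx_eq_pairIdx.1 h with ⟨h, -⟩ | ⟨h, -⟩
    · exact hmn h
    · exact hnem _ h
  have h := hX.integral_four_entries hQ (i₄ := n) (j₄ := e l) (hnem i) (hnen j) (hnem k)
  simp only [hmix, false_and, and_false, if_false, zero_add, add_zero, pairIdx_left_inj,
    he.eq_iff] at h
  rw [← h]
  congr with ω
  simp only [adjCoef]
  ring

/-! ### Expectations of the expansions -/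

end

/-- The mixed second moments of the minors of `X_e - μ` and `X_e - ν`. -/
noncomputable def minorCor (P : Measure Ω) (X : ℕ → ℕ → Ω → ℝ) (e : κ → ℕ) (μ ν : ℂ)
    (p q : Option (κ × κ)) : ℂ :=
  ∫ ω, minorVec X e μ p ω * minorVec X e ν q ω ∂P

lemma minorCor_swap (P : Measure Ω) (X : ℕ → ℕ → Ω → ℝ) (e : κ → ℕ) (μ ν : ℂ)
    (p q : Option (κ × κ)) : minorCor P X e μ ν p q = minorCor P X e ν μ q p := by
  simp only [minorCor, mul_comm]

lemma IsWignerArray.minorCor_comm_right (hX : IsWignerArray P Q X) (e : κ → ℕ) (μ ν : ℂ)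
    (p : Option (κ × κ)) (k l : κ) :
    minorCor P X e μ ν p (some (k, l)) = minorCor P X e μ ν p (some (l, k)) := by
  simp only [minorCor, minorVec, hX.adjugate_charMat_comm e ν _ k l]

variable [IsProbabilityMeasure P]

/-- Source of the recursion for E[det · det]. Of the three pairings of four entries in one row, one
yields the product of traces. The other two agree by symmetry of the cofactors, whence the factor 2.
The excess b - 3 sits on the diagonal cofactors. -/
lemma IsWignerArray.integral_expansion_same (hX : IsWignerArray P Q X)
    (hQ : HasWignerMoments Q) {e : κ → ℕ} (he : e.Injective) {n : ℕ} (hn : n ∉ Set.range e)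
    (hL : ∀ μ p, MemLp (minorVec X e μ p) 2 P) (μ ν : ℂ) :
    ∫ ω, (∑ p, detCoef X n e μ p ω * minorVec X e μ p ω) *
        (∑ p, detCoef X n e ν p ω * minorVec X e ν p ω) ∂P =
      (2 + μ * ν) * minorCor P X e μ ν none none +
      μ * ∑ k, minorCor P X e μ ν none (some (k, k)) +
      ν * ∑ k, minorCor P X e μ ν (some (k, k)) none +
      ∑ i, ∑ k, minorCor P X e μ ν (some (i, i)) (some (k, k)) +
      2 * ∑ i, ∑ j, minorCor P X e μ ν (some (i, j)) (some (i, j)) +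
      (((∫ x, x ^ 4 ∂Q : ℝ) : ℂ) - 3) *
        ∑ i, minorCor P X e μ ν (some (i, i)) (some (i, i)) := by
  rw [hX.integral_sum_mul_sum disjoint_compl_left (hX.measurable_detCoef hn μ)
    (hX.measurable_detCoef hn ν) (hX.measurable_minorVec e μ) (hX.measurable_minorVec e ν)
    (hX.memLp_two_detCoef hQ n e μ) (hX.memLp_two_detCoef hQ n e ν) (hL μ) (hL ν)]
  simp only [Fintype.sum_option, Fintype.sum_prod_type, hX.integral_detCoef_none_none hQ,
    hX.integral_detCoef_none_some hQ he hn, hX.integral_detCoef_some_none hQ he hn,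
    hX.integral_detCoef_some_some hQ he hn]
  simp only [← minorCor.eq_def, add_mul, Finset.sum_add_distrib, ite_and, ite_mul, zero_mul,
    Finset.sum_ite_eq, Finset.sum_ite_irrel, Finset.sum_const_zero, Finset.mem_univ, if_true,
    one_mul, Finset.mul_sum]
  have hR : ∑ i, ∑ j, minorCor P X e μ ν (some (i, j)) (some (j, i)) =
      ∑ i, ∑ j, minorCor P X e μ ν (some (i, j)) (some (i, j)) :=
    Finset.sum_congr rfl fun i _ => Finset.sum_congr rfl fun j _ =>
      hX.minorCor_comm_right e μ ν _ j i
  rw [hR]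
  simp only [← Finset.mul_sum]
  ring

/-- Source of the recursions for `D` and `D'`: a diagonal cofactor does not involve the expanded
row, so only the means of the coefficients enter. -/
lemma IsWignerArray.integral_expansion_mul_det (hX : IsWignerArray P Q X)
    (hQ : HasWignerMoments Q) {e : κ → ℕ} (he : e.Injective) {n : ℕ} (hn : n ∉ Set.range e)
    (hL : ∀ μ p, MemLp (minorVec X e μ p) 2 P) (μ ν : ℂ) :
    ∫ ω, (∑ p, detCoef X n e μ p ω * minorVec X e μ p ω) * minorVec X e ν none ω ∂P =
      -μ * minorCor P X e μ ν none none - ∑ k, minorCor P X e μ ν (some (k, k)) none := by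
  have h := hX.integral_sum_mul_sum disjoint_compl_left (hX.measurable_detCoef hn μ)
    (t := fun _ : Unit => fun _ => 1) (W := fun _ : Unit => minorVec X e ν none)
    (fun _ => measurable_const) (hX.measurable_minorVec e μ)
    (fun _ => hX.measurable_minorVec e ν none)
    (hX.memLp_two_detCoef hQ n e μ) (fun _ => memLp_const 1) (hL μ) (fun _ => hL ν none)
  simp only [Finset.univ_unique, Finset.sum_singleton, one_mul, mul_one] at h
  rw [h]
  simp only [Fintype.sum_option, Fintype.sum_prod_type, hX.integral_detCoef_none hQ,
    hX.integral_detCoef_some hQ he hn, neg_mul, ite_mul, one_mul, zero_mul,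
    Finset.sum_neg_distrib, Finset.sum_ite_eq, Finset.mem_univ, if_true, ← minorCor.eq_def]
  ring

/-- Off-diagonal terms of `S`: two different diagonal cofactors, each expanded along the row that
the other lacks. These rows are independent, so only products of means remain, namely those of (-μ
det - tr adj)(-ν det - tr adj). -/
lemma IsWignerArray.integral_expansion_distinct (hX : IsWignerArray P Q X)
    (hQ : HasWignerMoments Q) {e : κ → ℕ} (he : e.Injective) {m n : ℕ} (hm : m ∉ Set.range e)
    (hn : n ∉ Set.range e) (hmn : m ≠ n)
    (hL : ∀ μ p, MemLp (minorVec X e μ p) 2 P) (μ ν : ℂ) :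
    ∫ ω, (∑ p, detCoef X m e μ p ω * minorVec X e μ p ω) *
        (∑ p, detCoef X n e ν p ω * minorVec X e ν p ω) ∂P =
      μ * ν * minorCor P X e μ ν none none +
      μ * ∑ k, minorCor P X e μ ν none (some (k, k)) +
      ν * ∑ k, minorCor P X e μ ν (some (k, k)) none +
      ∑ i, ∑ k, minorCor P X e μ ν (some (i, i)) (some (k, k)) := by
  rw [hX.integral_sum_mul_sum disjoint_compl_left (hX.measurable_detCoef hm μ)
    (hX.measurable_detCoef hn ν) (hX.measurable_minorVec e μ) (hX.measurable_minorVec e ν)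
    (hX.memLp_two_detCoef hQ m e μ) (hX.memLp_two_detCoef hQ n e ν) (hL μ) (hL ν)]
  simp only [hX.integral_mul (disjoint_rowPairs hm hmn) (hX.measurable_detCoef_row e m μ _)
    (hX.measurable_detCoef_row e n ν _)]
  simp only [Fintype.sum_option, Fintype.sum_prod_type, hX.integral_detCoef_none hQ,
    hX.integral_detCoef_some hQ he hm, hX.integral_detCoef_some hQ he hn, neg_mul, mul_neg,
    ite_mul, mul_ite, one_mul, zero_mul, mul_one, mul_zero,
    Finset.sum_neg_distrib, Finset.sum_ite_eq, Finset.sum_ite_irrel, Finset.sum_const_zero,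
    Finset.sum_add_distrib, Finset.mem_univ, if_true, ← minorCor.eq_def, Finset.mul_sum]
  ring

/-- Off-diagonal terms of `R`: the coefficients of an off-diagonal cofactor are orthonormal in L².
-/
lemma IsWignerArray.integral_expansion_adjugate (hX : IsWignerArray P Q X)
    (hQ : HasWignerMoments Q) {e : κ → ℕ} (he : e.Injective) {m n : ℕ} (hm : m ∉ Set.range e)
    (hn : n ∉ Set.range e) (hmn : m ≠ n)
    (hL : ∀ μ p, MemLp (minorVec X e μ p) 2 P) (μ ν : ℂ) :
    ∫ ω, (∑ p, adjCoef X m n e p ω * minorVec X e μ p ω) *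
        (∑ p, adjCoef X m n e p ω * minorVec X e ν p ω) ∂P =
      minorCor P X e μ ν none none +
      ∑ i, ∑ j, minorCor P X e μ ν (some (i, j)) (some (i, j)) := by
  rw [hX.integral_sum_mul_sum disjoint_compl_left (hX.measurable_adjCoef hm hn)
    (hX.measurable_adjCoef hm hn) (hX.measurable_minorVec e μ) (hX.measurable_minorVec e ν)
    (hX.memLp_two_adjCoef hQ m n e) (hX.memLp_two_adjCoef hQ m n e) (hL μ) (hL ν)]
  have h : ∀ k l, ∫ ω, adjCoef X m n e (some (k, l)) ω * adjCoef X m n e none ω ∂P = 0 := by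
    intro k l
    rw [← hX.integral_adjCoef_none_some hQ hm hn k l]
    simp only [mul_comm]
  simp only [Fintype.sum_option, Fintype.sum_prod_type, hX.integral_adjCoef_none_none hQ e hmn,
    hX.integral_adjCoef_none_some hQ hm hn, h, hX.integral_adjCoef_some_some hQ he hm hn hmn,
    ite_and, ite_mul, one_mul, zero_mul, zero_add,
    Finset.sum_ite_eq, Finset.sum_ite_irrel, Finset.sum_const_zero, add_zero,
    Finset.sum_add_distrib, Finset.mem_univ, if_true, ← minorCor.eq_def]

end Recursion

/-! ### Induction on the matrix size. -/

section Induction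

variable {Ω : Type*} [MeasurableSpace Ω] {P : Measure Ω} {Q : Measure ℝ} {X : ℕ → ℕ → Ω → ℝ}

lemma exists_equiv_option {ι : Type} [Fintype ι] [DecidableEq ι] (i : ι) :
    ∃ (κ : Type) (_ : Fintype κ) (_ : DecidableEq κ) (φ : Option κ ≃ ι),
      φ none = i ∧ Fintype.card ι = Fintype.card κ + 1 :=
  ⟨{k // k ≠ i}, inferInstance, inferInstance, Equiv.optionSubtypeNe i, by simp, by
    rw [← Fintype.card_congr (Equiv.optionSubtypeNe i), Fintype.card_option]⟩

lemma exists_equiv_option_option {ι : Type} [Fintype ι] [DecidableEq ι] {i j : ι} (hij : i ≠ j) :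
    ∃ (κ : Type) (_ : Fintype κ) (_ : DecidableEq κ) (φ : Option (Option κ) ≃ ι),
      φ none = i ∧ φ (some none) = j ∧ Fintype.card ι = Fintype.card κ + 2 := by
  obtain ⟨κ, _, _, φ, h0, hc⟩ := exists_equiv_option i
  obtain ⟨k, hk⟩ : ∃ k, φ (some k) = j := by
    rcases h : φ.symm j with _ | k
    · exact absurd (by rw [← h0, ← h, Equiv.apply_symm_apply]) hij
    · exact ⟨k, by rw [← h, Equiv.apply_symm_apply]⟩
  obtain ⟨κ', _, _, ψ, h0', hc'⟩ := exists_equiv_option k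
  exact ⟨κ', inferInstance, inferInstance, (Equiv.optionCongr ψ).trans φ, by simp [h0],
    by simp [h0', hk], by omega⟩

lemma not_mem_range_comp_some {κ : Type*} {e : Option κ → ℕ} (he : e.Injective) :
    e none ∉ Set.range (e ∘ some) := by
  rintro ⟨k, hk⟩
  exact absurd (he hk) (by simp)

variable [IsProbabilityMeasure P]

/-- The determinant and the cofactors of `X_e - μ` are square-integrable. -/
lemma IsWignerArray.memLp_two_minorVec (hX : IsWignerArray P Q X) (hQ : HasWignerMoments Q)
    (n : ℕ) : ∀ {ι : Type} [Fintype ι] [DecidableEq ι] {e : ι → ℕ}, e.Injective →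
      Fintype.card ι = n → ∀ μ p, MemLp (minorVec X e μ p) 2 P := by
  -- Strong induction, because an off-diagonal cofactor falls back to size n - 2.
  induction n using Nat.strong_induction_on with
  | _ n ih =>
    intro ι _ _ e he hn μ p
    rcases p with _ | ⟨i, j⟩
    · rcases isEmpty_or_nonempty ι with hι | ⟨⟨i⟩⟩
      · simpa [minorVec] using memLp_const (1 : ℂ)
      · obtain ⟨κ, _, _, φ, h0, hc⟩ := exists_equiv_option i
        have hinj : (e ∘ φ).Injective := he.comp φ.injective
        have hL := ih (Fintype.card κ) (by omega)
          (hinj.comp (Option.some_injective κ)) rfl μ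
        have hr := not_mem_range_comp_some hinj
        have h : minorVec X e μ none = fun ω => ∑ p, detCoef X (e (φ none)) ((e ∘ φ) ∘ some) μ p ω *
            minorVec X ((e ∘ φ) ∘ some) μ p ω := by
          funext ω
          simp only [minorVec]
          rw [← det_charMat_comp_equiv e φ, hX.det_charMat_option]
          rfl
        rw [h]
        exact memLp_finsetSum _ fun p _ => hX.memLp_two_mul disjoint_compl_left
          (hX.measurable_detCoef hr μ p) (hX.measurable_minorVec _ μ p)
          (hX.memLp_two_detCoef hQ _ _ μ p) (hL p)
    · rcases eq_or_ne i j with rfl | hij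
      · obtain ⟨κ, _, _, φ, rfl, hc⟩ := exists_equiv_option i
        have hinj : (e ∘ φ).Injective := he.comp φ.injective
        have hL := ih (Fintype.card κ) (by omega)
          (hinj.comp (Option.some_injective κ)) rfl μ none
        convert! hL using 1
        funext ω
        simp only [minorVec]
        rw [← adjugate_charMat_comp_equiv e φ, hX.adjugate_charMat_none_none]
      · obtain ⟨κ, _, _, φ, rfl, rfl, hc⟩ := exists_equiv_option_option hij
        have hinj : (e ∘ φ).Injective := he.comp φ.injective
        have hinj' := hinj.comp (Option.some_injective _)
        have hL := ih (Fintype.card κ) (by omega)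
          (hinj'.comp (Option.some_injective κ)) rfl μ
        have hr' := not_mem_range_comp_some hinj'
        have hr : (e ∘ φ) none ∉ Set.range ((e ∘ φ) ∘ some ∘ some) := by
          rintro ⟨k, hk⟩
          exact absurd (hinj hk) (by simp)
        have h : minorVec X e μ (some (φ none, φ (some none))) = fun ω =>
            ∑ p, adjCoef X ((e ∘ φ) none) ((e ∘ φ) (some none)) ((e ∘ φ) ∘ some ∘ some) p ω *
            minorVec X ((e ∘ φ) ∘ some ∘ some) μ p ω := by
          funext ω
          simp only [minorVec]
          rw [← adjugate_charMat_comp_equiv e φ, hX.adjugate_charMat_none_some]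
          rfl
        rw [h]
        exact memLp_finsetSum _ fun p _ => hX.memLp_two_mul disjoint_compl_left
          (hX.measurable_adjCoef hr hr' p) (hX.measurable_minorVec _ μ p)
          (hX.memLp_two_adjCoef hQ _ _ _ p) (hL p)

lemma sum_sum_of_diag_of_offdiag {ι : Type*} [Fintype ι] [DecidableEq ι] {T : ι → ι → ℂ}
    {a c : ℂ} (hd : ∀ i, T i i = a) (ho : ∀ i j, i ≠ j → T i j = c) :
    ∑ i, ∑ j, T i j = Fintype.card ι * (a + (Fintype.card ι - 1) * c) := by
  have h : ∀ i, ∑ j, T i j = a + (Fintype.card ι - 1) * c := by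
    intro i
    have hT : ∀ j, T i j = c + if j = i then a - c else 0 := by
      intro j
      split_ifs with h
      · rw [h, hd]; ring
      · rw [ho i j (Ne.symm h), add_zero]
    simp only [hT, Finset.sum_add_distrib, Finset.sum_ite_eq', Finset.mem_univ, if_true,
      Finset.sum_const, Finset.card_univ, nsmul_eq_mul]
    ring
  simp [h, mul_add]

/-- The sequence `0, a 0, a 1, …`. -/
def shiftSeq (a : ℕ → ℂ) : ℕ → ℂ
  | 0 => 0
  | n + 1 => a n

/-- The recursions for the normalized mixed moments of the determinants and cofactors of
`X_N - μ` and `X_N - ν`. -/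
structure IsMinorRecursion (b μ ν : ℂ) (F D D' S R : ℕ → ℂ) : Prop where
  F_zero : F 0 = 1
  D_zero : D 0 = 0
  D'_zero : D' 0 = 0
  S_zero : S 0 = 0
  R_zero : R 0 = 0
  F_succ : ∀ n : ℕ, (n + 1) * F (n + 1) =
    (2 + μ * ν) * F n + μ * D n + ν * D' n + S n + 2 * R n + (b - 3) * shiftSeq F n
  D_succ : ∀ n, D (n + 1) = -μ * F n - D' n
  D'_succ : ∀ n, D' (n + 1) = -ν * F n - D n
  S_succ : ∀ n, S (n + 1) =
    F n + shiftSeq (fun k => μ * ν * F k + μ * D k + ν * D' k + S k) n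
  R_succ : ∀ n, R (n + 1) = F n + shiftSeq (fun k => F k + R k) n

/-- The five moments depend on the index set only through its size. The claim covers all injections
`e` at once because deleting a row changes `e`. The recursion determines the sequences, so any
solution, in particular one read off from a generating function, gives the moments. -/
lemma IsWignerArray.minorCor_eq (hX : IsWignerArray P Q X) (hQ : HasWignerMoments Q)
    {μ ν : ℂ} {F D D' S R : ℕ → ℂ}
    (hrec : IsMinorRecursion ((∫ x, x ^ 4 ∂Q : ℝ) : ℂ) μ ν F D D' S R)
    (n : ℕ) : ∀ {ι : Type} [Fintype ι] [DecidableEq ι] {e : ι → ℕ}, e.Injective →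
      Fintype.card ι = n →
      minorCor P X e μ ν none none = n.factorial * F n ∧
      ∑ k, minorCor P X e μ ν none (some (k, k)) = n.factorial * D n ∧
      ∑ k, minorCor P X e μ ν (some (k, k)) none = n.factorial * D' n ∧
      ∑ i, ∑ k, minorCor P X e μ ν (some (i, i)) (some (k, k)) = n.factorial * S n ∧
      ∑ i, ∑ k, minorCor P X e μ ν (some (i, k)) (some (i, k)) = n.factorial * R n := by
  induction n using Nat.strong_induction_on with
  | _ n ih =>
    have hdiag : ∀ m < n, ∀ {ι : Type} [Fintype ι] [DecidableEq ι] {e : ι → ℕ}, e.Injective →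
        Fintype.card ι = m + 1 → ∀ i : ι,
        minorCor P X e μ ν (some (i, i)) (some (i, i)) = m.factorial * F m := by
      intro m hm ι _ _ e he hn i
      obtain ⟨κ, _, _, φ, rfl, hc⟩ := exists_equiv_option i
      have hinj : (e ∘ φ).Injective := he.comp φ.injective
      rw [← (ih m hm (hinj.comp (Option.some_injective κ)) (by omega)).1]
      simp only [minorCor, minorVec]
      simp only [← adjugate_charMat_comp_equiv e φ, hX.adjugate_charMat_none_none]
    intro ι _ _ e he hn
    have hdet : ∀ i : ι, ∀ m, n = m + 1 →
        minorCor P X e μ ν none (some (i, i)) = m.factorial * D (m + 1) ∧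
        minorCor P X e μ ν (some (i, i)) none = m.factorial * D' (m + 1) := by
      intro i m hm
      obtain ⟨κ, _, _, φ, rfl, hc⟩ := exists_equiv_option i
      have hinj : (e ∘ φ).Injective := he.comp φ.injective
      have hinj' := hinj.comp (Option.some_injective κ)
      obtain ⟨h1, h2, h3, -, -⟩ := ih m (by omega) hinj' (by omega)
      have hL := hX.memLp_two_minorVec hQ _ hinj' rfl
      have hr := not_mem_range_comp_some hinj
      have e1 := hX.integral_expansion_mul_det hQ hinj' hr hL μ ν
      have e2 := hX.integral_expansion_mul_det hQ hinj' hr hL ν μ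
      simp only [minorCor_swap P X _ ν μ] at e2
      rw [h1, h2] at e2
      rw [h1, h3] at e1
      constructor
      · have : minorCor P X e μ ν none (some (φ none, φ none)) =
            m.factorial * (-μ * F m - D' m) := by
          rw [show (m.factorial : ℂ) * (-μ * F m - D' m) =
            -μ * (m.factorial * F m) - m.factorial * D' m by ring, ← e1]
          simp only [minorCor, minorVec]
          simp only [← adjugate_charMat_comp_equiv e φ, ← det_charMat_comp_equiv e φ,
            hX.adjugate_charMat_none_none]
          simp only [hX.det_charMat_option (e ∘ φ), minorVec]
        rw [this, hrec.D_succ]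
      · have : minorCor P X e μ ν (some (φ none, φ none)) none =
            m.factorial * (-ν * F m - D m) := by
          rw [show (m.factorial : ℂ) * (-ν * F m - D m) =
            -ν * (m.factorial * F m) - m.factorial * D m by ring, ← e2, minorCor_swap]
          simp only [minorCor, minorVec]
          simp only [← adjugate_charMat_comp_equiv e φ, ← det_charMat_comp_equiv e φ,
            hX.adjugate_charMat_none_none]
          simp only [hX.det_charMat_option (e ∘ φ), minorVec]
        rw [this, hrec.D'_succ]
    have hoff : ∀ i j : ι, i ≠ j → ∀ m, n = m + 2 →
        minorCor P X e μ ν (some (i, i)) (some (j, j)) =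
          m.factorial * (μ * ν * F m + μ * D m + ν * D' m + S m) ∧
        minorCor P X e μ ν (some (i, j)) (some (i, j)) = m.factorial * (F m + R m) := by
      intro i j hij m hm
      obtain ⟨κ, _, _, φ, rfl, rfl, hc⟩ := exists_equiv_option_option hij
      have hinj : (e ∘ φ).Injective := he.comp φ.injective
      have hinj' := hinj.comp (Option.some_injective _)
      have hinj'' := hinj'.comp (Option.some_injective κ)
      obtain ⟨h1, h2, h3, h4, h5⟩ := ih m (by omega) hinj'' (by omega)
      have hL := hX.memLp_two_minorVec hQ _ hinj'' rfl
      have hrn := not_mem_range_comp_some hinj'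
      have hrm : (e ∘ φ) none ∉ Set.range ((e ∘ φ) ∘ some ∘ some) := by
        rintro ⟨k, hk⟩
        exact absurd (hinj hk) (by simp)
      have hmn : (e ∘ φ) none ≠ ((e ∘ φ) ∘ some) none := fun h => absurd (hinj h) (by simp)
      have e1 := hX.integral_expansion_distinct hQ hinj'' hrn hrm hmn.symm hL μ ν
      have e2 := hX.integral_expansion_adjugate hQ hinj'' hrm hrn hmn hL μ ν
      rw [h1, h2, h3, h4] at e1
      rw [h1, h5] at e2
      constructor
      · rw [show (m.factorial : ℂ) * (μ * ν * F m + μ * D m + ν * D' m + S m) =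
          μ * ν * (m.factorial * F m) + μ * (m.factorial * D m) + ν * (m.factorial * D' m) +
            m.factorial * S m by ring, ← e1]
        simp only [minorCor, minorVec]
        simp only [← adjugate_charMat_comp_equiv e φ, hX.adjugate_charMat_none_none,
          hX.adjugate_charMat_some_none]
        simp only [hX.det_charMat_option ((e ∘ φ) ∘ some),
          hX.det_charMat_option ((e ∘ φ) ∘ Option.map some)]
        rfl
      · rw [mul_add, ← e2]
        simp only [minorCor, minorVec]
        simp only [← adjugate_charMat_comp_equiv e φ, hX.adjugate_charMat_none_some]
        rfl
    have hFn : minorCor P X e μ ν none none = n.factorial * F n := by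
      rcases isEmpty_or_nonempty ι with hι | ⟨⟨i⟩⟩
      · obtain rfl : n = 0 := by rw [← hn, Fintype.card_eq_zero]
        simp [minorCor, minorVec, hrec.F_zero]
      · obtain ⟨κ, _, _, φ, h0, hc⟩ := exists_equiv_option i
        obtain ⟨m, rfl⟩ : ∃ m, n = m + 1 := ⟨Fintype.card κ, by omega⟩
        have hinj : (e ∘ φ).Injective := he.comp φ.injective
        have hinj' := hinj.comp (Option.some_injective κ)
        obtain ⟨h1, h2, h3, h4, h5⟩ := ih m (by omega) hinj' (by omega)
        have hL := hX.memLp_two_minorVec hQ _ hinj' rfl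
        have hr := not_mem_range_comp_some hinj
        have e1 := hX.integral_expansion_same hQ hinj' hr hL μ ν
        -- Each of the m diagonal terms equals (m - 1)! F (m - 1). The case m = 0 is the empty sum,
        -- matched by the leading 0 of `shiftSeq`.
        have h6 : ∑ k, minorCor P X ((e ∘ φ) ∘ some) μ ν (some (k, k)) (some (k, k)) =
            m.factorial * shiftSeq F m := by
          rcases m with _ | m
          · have := Fintype.card_eq_zero_iff.1 (show Fintype.card κ = 0 by omega)
            simp [shiftSeq]
          · rw [Finset.sum_congr rfl fun i _ => hdiag m (by omega) hinj' (by omega) i,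
              Finset.sum_const, Finset.card_univ, show Fintype.card κ = m + 1 by omega,
              Nat.factorial_succ, shiftSeq]
            push_cast
            ring
        rw [h1, h2, h3, h4, h5, h6] at e1
        have : minorCor P X e μ ν none none = m.factorial * ((m + 1) * F (m + 1)) := by
          rw [hrec.F_succ, show ∀ x y z u v w c : ℂ, c * ((2 + μ * ν) * x + μ * y + ν * z + u +
            2 * v + (((∫ x, x ^ 4 ∂Q : ℝ) : ℂ) - 3) * w) = (2 + μ * ν) * (c * x) + μ * (c * y) +
            ν * (c * z) + c * u + 2 * (c * v) + (((∫ x, x ^ 4 ∂Q : ℝ) : ℂ) - 3) * (c * w) by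
              intros; ring, ← e1]
          simp only [minorCor, minorVec]
          simp only [← det_charMat_comp_equiv e φ]
          simp only [hX.det_charMat_option (e ∘ φ)]
          rfl
        rw [this, Nat.factorial_succ]
        push_cast
        ring
    -- There are n diagonal terms carrying (n - 1)! and n(n - 1) off-diagonal terms carrying (n -
    -- 2)!, so both groups acquire n!. For n = 1 the second group is empty, and `shiftSeq` supplies
    -- 0.
    have hsum : ∀ {T : ι → ι → ℂ} {a c : ℕ → ℂ}, (∀ i m, n = m + 1 → T i i = m.factorial * a m) →
        (∀ i j, i ≠ j → ∀ m, n = m + 2 → T i j = m.factorial * c m) →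
        ∀ m, n = m + 1 → ∑ i, ∑ j, T i j = n.factorial * (a m + shiftSeq c m) := by
      rintro T a c hd ho (_ | m) rfl
      · have : Subsingleton ι := Fintype.card_le_one_iff_subsingleton.1 hn.le
        rw [sum_sum_of_diag_of_offdiag (c := 0) (fun i => hd i 0 rfl)
          fun i j h => absurd (Subsingleton.elim i j) h, hn]
        simp [shiftSeq]
      · rw [sum_sum_of_diag_of_offdiag (fun i => hd i _ rfl) fun i j h => ho i j h m rfl, hn,
          shiftSeq]
        simp only [Nat.factorial_succ]
        push_cast
        ring
    refine ⟨hFn, ?_, ?_, ?_, ?_⟩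
    · rcases n with _ | m
      · have := Fintype.card_eq_zero_iff.1 hn
        simp [hrec.D_zero]
      · rw [Finset.sum_congr rfl fun i _ => (hdet i m rfl).1, Finset.sum_const, Finset.card_univ,
          hn, Nat.factorial_succ]
        push_cast
        ring
    · rcases n with _ | m
      · have := Fintype.card_eq_zero_iff.1 hn
        simp [hrec.D'_zero]
      · rw [Finset.sum_congr rfl fun i _ => (hdet i m rfl).2, Finset.sum_const, Finset.card_univ,
          hn, Nat.factorial_succ]
        push_cast
        ring
    · rcases n with _ | m
      · have := Fintype.card_eq_zero_iff.1 hn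
        simp [hrec.S_zero]
      · rw [hrec.S_succ]
        exact hsum (fun i k hk => hdiag k (by omega) he (by omega) i)
          (fun i j h k hk => (hoff i j h k hk).1) m rfl
    · rcases n with _ | m
      · have := Fintype.card_eq_zero_iff.1 hn
        simp [hrec.R_zero]
      · rw [hrec.R_succ]
        exact hsum (fun i k hk => hdiag k (by omega) he (by omega) i)
          (fun i j h k hk => (hoff i j h k hk).2) m rfl

lemma charPolyProduct_eq_minorVec (X : ℕ → ℕ → Ω → ℝ) (N : ℕ) (μ ν : ℂ) (ω : Ω) :
    charPolyProduct X N μ ν ω = minorVec X (fun i : Fin N => (i : ℕ)) μ none ω *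
      minorVec X (fun i : Fin N => (i : ℕ)) ν none ω := by
  have h : ∀ μ : ℂ, wignerMatrix X N ω - μ • (1 : Matrix (Fin N) (Fin N) ℂ) =
      charMat X (fun i : Fin N => (i : ℕ)) μ ω := by
    intro μ
    ext i j
    simp [wignerMatrix, charMat, one_apply]
  simp only [charPolyProduct, minorVec, h]

lemma IsWignerArray.integrable_charPolyProduct (hX : IsWignerArray P Q X)
    (hQ : HasWignerMoments Q) (N : ℕ) (μ ν : ℂ) : Integrable (charPolyProduct X N μ ν) P := by
  have hL := hX.memLp_two_minorVec hQ N (e := fun i : Fin N => (i : ℕ)) Fin.val_injective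
    (Fintype.card_fin N)
  rw [show charPolyProduct X N μ ν = _ from funext (charPolyProduct_eq_minorVec X N μ ν)]
  exact (hL μ none).integrable_mul (hL ν none)

lemma IsWignerArray.charPolyCorrelation_eq (hX : IsWignerArray P Q X)
    (hQ : HasWignerMoments Q) {μ ν : ℂ} {F D D' S R : ℕ → ℂ}
    (hrec : IsMinorRecursion ((∫ x, x ^ 4 ∂Q : ℝ) : ℂ) μ ν F D D' S R) (N : ℕ) :
    charPolyCorrelation P X N μ ν = N.factorial * F N := by
  rw [← (hX.minorCor_eq hQ hrec N (e := fun i : Fin N => (i : ℕ)) Fin.val_injective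
    (Fintype.card_fin N)).1]
  simp only [charPolyCorrelation, charPolyProduct_eq_minorVec]
  rfl

end Induction

/-! ### The generating function and its differential equation. -/

section Taylor

/-- The Taylor coefficients of `f` at `0`. -/
noncomputable def taylorCoef (f : ℂ → ℂ) (n : ℕ) : ℂ := iteratedDeriv n f 0 / n.factorial

lemma taylorCoef_congr {f g : ℂ → ℂ} (h : f =ᶠ[𝓝 0] g) (n : ℕ) :
    taylorCoef f n = taylorCoef g n := by
  rw [taylorCoef, taylorCoef, h.iteratedDeriv_eq]

lemma taylorCoef_add {f g : ℂ → ℂ} (hf : AnalyticAt ℂ f 0) (hg : AnalyticAt ℂ g 0) (n : ℕ) :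
    taylorCoef (fun x => f x + g x) n = taylorCoef f n + taylorCoef g n := by
  rw [taylorCoef, iteratedDeriv_fun_add hf.contDiffAt hg.contDiffAt, add_div]
  rfl

lemma taylorCoef_const_mul (c : ℂ) (f : ℂ → ℂ) (n : ℕ) :
    taylorCoef (fun x => c * f x) n = c * taylorCoef f n := by
  rw [taylorCoef, iteratedDeriv_const_mul_field, mul_div_assoc]
  rfl

lemma taylorCoef_zero (f : ℂ → ℂ) : taylorCoef f 0 = f 0 := by
  simp [taylorCoef]

lemma taylorCoef_deriv (f : ℂ → ℂ) (n : ℕ) :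
    taylorCoef (deriv f) n = (n + 1) * taylorCoef f (n + 1) := by
  rw [taylorCoef, taylorCoef, iteratedDeriv_succ', Nat.factorial_succ]
  have : (n.factorial : ℂ) ≠ 0 := by exact_mod_cast n.factorial_ne_zero
  have : (n : ℂ) + 1 ≠ 0 := by exact_mod_cast n.succ_ne_zero
  push_cast
  field_simp

lemma taylorCoef_id_mul {f : ℂ → ℂ} (hf : AnalyticAt ℂ f 0) (n : ℕ) :
    taylorCoef (fun x => x * f x) n = shiftSeq (taylorCoef f) n := by
  rcases n with _ | n
  · simp [taylorCoef_zero, shiftSeq]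
  · rw [shiftSeq, taylorCoef, iteratedDeriv_fun_mul contDiffAt_fun_id hf.contDiffAt,
      taylorCoef, Nat.factorial_succ]
    simp only [iteratedDeriv_fun_id_zero, mul_ite, mul_one, mul_zero, ite_mul, zero_mul,
      Finset.sum_ite_eq', Finset.mem_range]
    rw [if_pos (by omega), Nat.choose_one_right, Nat.add_sub_cancel]
    have : (n : ℂ) + 1 ≠ 0 := by exact_mod_cast n.succ_ne_zero
    push_cast
    rw [mul_div_mul_left _ _ this]

/-- The exponential generating function of the correlations. -/
noncomputable def genFun (b μ ν x : ℂ) : ℂ :=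
  Complex.exp ((b - 3) / 2 * x ^ 2 - 5 / 2 * Complex.log (1 - x) - 1 / 2 * Complex.log (1 + x) +
    (μ * ν * x - (μ ^ 2 + ν ^ 2) / 2 * x ^ 2) / (1 - x ^ 2))

lemma one_sub_mem_slitPlane {x : ℂ} (hx : ‖x‖ < 1) : 1 - x ∈ Complex.slitPlane := by
  left
  have := (abs_le.1 (Complex.abs_re_le_norm x)).2
  simp
  linarith

lemma one_add_mem_slitPlane {x : ℂ} (hx : ‖x‖ < 1) : 1 + x ∈ Complex.slitPlane := by
  simpa using one_sub_mem_slitPlane (x := -x) (by simpa using hx)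

/-- The logarithmic derivative is the coefficient of Φ left when the generating functions of `D`,
`D'`, `S` and `R` are eliminated from the recursion for `F`. -/
lemma hasDerivAt_genFun (b μ ν : ℂ) {x : ℂ} (hx : ‖x‖ < 1) :
    HasDerivAt (genFun b μ ν) (genFun b μ ν x * (2 / (1 - x) + x / (1 - x ^ 2) + (b - 3) * x +
      (μ * ν * (1 + x ^ 2) - (μ ^ 2 + ν ^ 2) * x) / (1 - x ^ 2) ^ 2)) x := by
  have h1 := one_sub_mem_slitPlane hx
  have h2 := one_add_mem_slitPlane hx
  have n1 := Complex.slitPlane_ne_zero h1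
  have n2 := Complex.slitPlane_ne_zero h2
  have n3 : 1 - x ^ 2 ≠ 0 := by
    rw [show 1 - x ^ 2 = (1 - x) * (1 + x) by ring]
    exact mul_ne_zero n1 n2
  have hid := hasDerivAt_id' x
  have d1 := ((hid.const_sub 1).clog h1).const_mul (5 / 2 : ℂ)
  have d2 := ((hid.const_add 1).clog h2).const_mul (1 / 2 : ℂ)
  have d3 := ((hid.const_mul (μ * ν)).sub ((hid.fun_pow 2).const_mul ((μ ^ 2 + ν ^ 2) / 2))).div
    ((hid.fun_pow 2).const_sub 1) n3
  have d4 := (hid.fun_pow 2).const_mul ((b - 3) / 2)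
  have d := (((d4.sub d1).sub d2).add d3).cexp
  convert! d using 1
  simp only [genFun]
  congr 1
  rw [show 1 - x ^ 2 = (1 - x) * (1 + x) by ring]
  simp only [Pi.sub_apply, Nat.cast_ofNat, Nat.add_one_sub_one, pow_one, mul_one]
  field_simp
  ring

lemma differentiableOn_genFun (b μ ν : ℂ) : DifferentiableOn ℂ (genFun b μ ν) (Metric.ball 0 1) :=
  fun _ hx => (hasDerivAt_genFun b μ ν (by simpa using hx)).differentiableAt.differentiableWithinAt

lemma analyticAt_genFun (b μ ν : ℂ) : AnalyticAt ℂ (genFun b μ ν) 0 :=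
  (differentiableOn_genFun b μ ν).analyticAt (Metric.ball_mem_nhds 0 one_pos)

lemma genFun_zero (b μ ν : ℂ) : genFun b μ ν 0 = 1 := by simp [genFun]

/-- The Taylor coefficients of the generating function solve the recursion. -/
lemma isMinorRecursion_taylorCoef (b μ ν : ℂ) :
    ∃ D D' S R : ℕ → ℂ, IsMinorRecursion b μ ν (taylorCoef (genFun b μ ν)) D D' S R := by
  set Φ := genFun b μ ν with hΦ
  have aΦ : AnalyticAt ℂ Φ 0 := analyticAt_genFun b μ ν
  -- The linear relations for the four auxiliary generating functions are solved in terms of Φ. The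
  -- solutions are x d, x d', x s and x r; the factor x reflects that these sequences start with 0.
  set d : ℂ → ℂ := fun x => (-μ + ν * x) / (1 - x ^ 2) * Φ x with hd
  set d' : ℂ → ℂ := fun x => (-ν + μ * x) / (1 - x ^ 2) * Φ x with hd'
  set r : ℂ → ℂ := fun x => 1 / (1 - x) * Φ x with hr
  set s : ℂ → ℂ := fun x =>
    (Φ x + x * (μ * ν * Φ x + μ * (x * d x) + ν * (x * d' x))) / (1 - x ^ 2) with hs
  have ad : AnalyticAt ℂ d 0 := by
    refine AnalyticAt.mul (AnalyticAt.div (by fun_prop) (by fun_prop) (by simp)) aΦ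
  have ad' : AnalyticAt ℂ d' 0 := by
    refine AnalyticAt.mul (AnalyticAt.div (by fun_prop) (by fun_prop) (by simp)) aΦ
  have ar : AnalyticAt ℂ r 0 := by
    refine AnalyticAt.mul (AnalyticAt.div (by fun_prop) (by fun_prop) (by simp)) aΦ
  have as : AnalyticAt ℂ s 0 := AnalyticAt.div (by fun_prop) (by fun_prop) (by simp)
  have hball : ∀ᶠ x : ℂ in 𝓝 0, 1 - x ≠ 0 ∧ 1 + x ≠ 0 ∧ HasDerivAt Φ (Φ x * (2 / (1 - x) +
      x / (1 - x ^ 2) + (b - 3) * x +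
      (μ * ν * (1 + x ^ 2) - (μ ^ 2 + ν ^ 2) * x) / (1 - x ^ 2) ^ 2)) x := by
    filter_upwards [Metric.ball_mem_nhds (0 : ℂ) one_pos] with x hx
    have hx' : ‖x‖ < 1 := by simpa using hx
    exact ⟨Complex.slitPlane_ne_zero (one_sub_mem_slitPlane hx'),
      Complex.slitPlane_ne_zero (one_add_mem_slitPlane hx'), hasDerivAt_genFun b μ ν hx'⟩
  refine ⟨taylorCoef fun x => x * d x, taylorCoef fun x => x * d' x, taylorCoef fun x => x * s x,
    taylorCoef fun x => x * r x, ?_, ?_, ?_, ?_, ?_, ?_, ?_, ?_, ?_, ?_⟩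
  · rw [taylorCoef_zero, hΦ, genFun_zero]
  · simp [taylorCoef_zero]
  · simp [taylorCoef_zero]
  · simp [taylorCoef_zero]
  · simp [taylorCoef_zero]
  · intro n
    rw [← taylorCoef_deriv, ← taylorCoef_id_mul aΦ, ← taylorCoef_const_mul, ← taylorCoef_const_mul,
      ← taylorCoef_const_mul, ← taylorCoef_const_mul, ← taylorCoef_const_mul,
      ← taylorCoef_add (by fun_prop) (by fun_prop), ← taylorCoef_add (by fun_prop) (by fun_prop),
      ← taylorCoef_add (by fun_prop) (by fun_prop), ← taylorCoef_add (by fun_prop) (by fun_prop),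
      ← taylorCoef_add (by fun_prop) (by fun_prop)]
    -- What remains is Φ' = (2 + μν)Φ + μxd + νxd' + xs + 2xr + (b - 3)xΦ near 0.
    refine taylorCoef_congr ?_ n
    filter_upwards [hball] with x ⟨h1, h2, h3⟩
    rw [h3.deriv]
    simp only [hs, hd, hd', hr]
    rw [show 1 - x ^ 2 = (1 - x) * (1 + x) by ring]
    field_simp
    ring
  · intro n
    rw [taylorCoef_id_mul ad, taylorCoef_id_mul ad', shiftSeq, ← taylorCoef_id_mul ad',
      sub_eq_add_neg, neg_eq_neg_one_mul (taylorCoef _ n), ← taylorCoef_const_mul,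
      ← taylorCoef_const_mul, ← taylorCoef_add (by fun_prop) (by fun_prop)]
    refine taylorCoef_congr ?_ n
    filter_upwards [hball] with x ⟨h1, h2, h3⟩
    simp only [hd, hd']
    rw [show 1 - x ^ 2 = (1 - x) * (1 + x) by ring]
    field_simp
    ring
  · intro n
    rw [taylorCoef_id_mul ad', taylorCoef_id_mul ad, shiftSeq, ← taylorCoef_id_mul ad,
      sub_eq_add_neg, neg_eq_neg_one_mul (taylorCoef _ n), ← taylorCoef_const_mul,
      ← taylorCoef_const_mul, ← taylorCoef_add (by fun_prop) (by fun_prop)]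
    refine taylorCoef_congr ?_ n
    filter_upwards [hball] with x ⟨h1, h2, h3⟩
    simp only [hd, hd']
    rw [show 1 - x ^ 2 = (1 - x) * (1 + x) by ring]
    field_simp
    ring
  · intro n
    have hU : (fun k => μ * ν * taylorCoef Φ k + μ * taylorCoef (fun x => x * d x) k +
        ν * taylorCoef (fun x => x * d' x) k + taylorCoef (fun x => x * s x) k) =
        taylorCoef fun x => μ * ν * Φ x + μ * (x * d x) + ν * (x * d' x) + x * s x := by
      funext k
      rw [← taylorCoef_const_mul, ← taylorCoef_const_mul, ← taylorCoef_const_mul,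
        ← taylorCoef_add (by fun_prop) (by fun_prop), ← taylorCoef_add (by fun_prop) (by fun_prop),
        ← taylorCoef_add (by fun_prop) (by fun_prop)]
    rw [hU, taylorCoef_id_mul as, shiftSeq, ← taylorCoef_id_mul (by fun_prop),
      ← taylorCoef_add (by fun_prop) (by fun_prop)]
    refine taylorCoef_congr ?_ n
    filter_upwards [hball] with x ⟨h1, h2, h3⟩
    simp only [hs, hd, hd']
    rw [show 1 - x ^ 2 = (1 - x) * (1 + x) by ring]
    field_simp
    ring
  · intro n
    have hU : (fun k => taylorCoef Φ k + taylorCoef (fun x => x * r x) k) =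
        taylorCoef fun x => Φ x + x * r x := by
      funext k
      rw [← taylorCoef_add (by fun_prop) (by fun_prop)]
    rw [hU, taylorCoef_id_mul ar, shiftSeq, ← taylorCoef_id_mul (by fun_prop),
      ← taylorCoef_add (by fun_prop) (by fun_prop)]
    refine taylorCoef_congr ?_ n
    filter_upwards [hball] with x ⟨h1, h2, h3⟩
    simp only [hr]
    field_simp
    ring

end Taylor

/-! ### Cauchy's formula and bounds along the contour. -/

section Contour

open Complex in
/-- Cauchy's formula for the Taylor coefficient of order `N` on the circle of radius
`exp (-1 / N)`, in a rescaled angular variable. -/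
lemma taylorCoef_eq_integral {f : ℂ → ℂ} (hf : DifferentiableOn ℂ f (Metric.ball 0 1)) {N : ℕ}
    (hN : 0 < N) :
    taylorCoef f N = 1 / (2 * Real.pi * N) * ∫ u in (-(Real.pi * N))..(Real.pi * N),
      f (exp (-(1 - u * I) / N)) * exp (1 - u * I) := by
  have hN' : (0 : ℝ) < N := by exact_mod_cast hN
  have hNc : (N : ℂ) ≠ 0 := by exact_mod_cast hN.ne'
  have hr0 : 0 < Real.exp (-1 / N) := Real.exp_pos _
  have hr1 : Real.exp (-1 / N) < 1 := by
    rw [Real.exp_lt_one_iff]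
    exact div_neg_of_neg_of_pos (by norm_num) hN'
  have hd : DiffContOnCl ℂ f (Metric.ball 0 (Real.exp (-1 / N))) := by
    refine (hf.mono ?_).diffContOnCl
    rw [closure_ball _ hr0.ne']
    exact Metric.closedBall_subset_ball hr1
  have h := hd.circleIntegral_one_div_sub_center_pow_smul hr0 N
  set g : ℝ → ℂ := fun θ => f (circleMap 0 (Real.exp (-1 / N)) θ) /
    circleMap 0 (Real.exp (-1 / N)) θ ^ N with hg
  -- Periodicity moves the angle to [-π, π], which places the dominant point x = 1 in the middle.
  have hper : Function.Periodic g (2 * Real.pi) := by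
    intro θ
    simp only [hg, periodic_circleMap 0 _ θ]
  have h1 : (∮ z in C(0, Real.exp (-1 / N)), (1 / (z - 0) ^ (N + 1)) • f z) =
      I * ∫ θ in (-Real.pi)..Real.pi, g θ := by
    rw [circleIntegral, ← intervalIntegral.integral_const_mul]
    have h2 := hper.intervalIntegral_add_eq 0 (-Real.pi)
    rw [zero_add, show -Real.pi + 2 * Real.pi = Real.pi by ring] at h2
    rw [intervalIntegral.integral_const_mul, ← h2, ← intervalIntegral.integral_const_mul]
    congr with θ
    have hz : circleMap 0 (Real.exp (-1 / N)) θ ≠ 0 := circleMap_ne_center hr0.ne'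
    simp only [hg, deriv_circleMap, sub_zero, smul_eq_mul]
    generalize circleMap 0 (Real.exp (-1 / N)) θ = z at hz ⊢
    field_simp
    ring
  have h3 : ∫ u in (-(Real.pi * N))..(Real.pi * N),
      f (exp (-(1 - u * I) / N)) * exp (1 - u * I) = N * ∫ θ in (-Real.pi)..Real.pi, g θ := by
    have h4 := intervalIntegral.integral_comp_div (a := -(Real.pi * N)) (b := Real.pi * N) g hN'.ne'
    rw [neg_div, mul_div_cancel_right₀ _ hN'.ne'] at h4
    rw [Complex.real_smul, Complex.ofReal_natCast] at h4
    rw [← h4]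
    congr with u
    have hx : circleMap 0 (Real.exp (-1 / N)) (u / N) = exp (-(1 - u * I) / N) := by
      rw [circleMap, zero_add, Complex.ofReal_exp, ← Complex.exp_add]
      congr 1
      push_cast
      ring
    simp only [hg, hx]
    -- Here x^N = exp(-(1 - iu)) exactly, so the division by x^N becomes the factor exp(1 - iu).
    rw [← Complex.exp_nat_mul, div_eq_mul_inv (f _), ← Complex.exp_neg]
    congr 2
    field_simp
  rw [h3]
  rw [h1] at h
  rw [taylorCoef]
  have hfac : (N.factorial : ℂ) ≠ 0 := by exact_mod_cast N.factorial_ne_zero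
  have hpi : (Real.pi : ℂ) ≠ 0 := by exact_mod_cast Real.pi_ne_zero
  rw [smul_eq_mul] at h
  field_simp
  field_simp at h
  linear_combination -h

lemma exp_neg_le_one_sub_half {t : ℝ} (h0 : 0 ≤ t) (h1 : t ≤ 1) : Real.exp (-t) ≤ 1 - t / 2 := by
  rw [Real.exp_neg, inv_le_comm₀ (Real.exp_pos t) (by linarith)]
  refine le_trans ?_ (Real.add_one_le_exp t)
  rw [inv_le_iff_one_le_mul₀ (by linarith)]
  nlinarith

lemma norm_exp_contour (u : ℝ) (N : ℕ) :
    ‖Complex.exp (-(1 - u * Complex.I) / N)‖ = Real.exp (-(1 / N)) := by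
  rw [Complex.norm_exp]
  congr 1
  rw [Complex.div_natCast_re]
  simp [neg_div]

lemma exp_contour (u : ℝ) (N : ℕ) :
    Complex.exp (-(1 - u * Complex.I) / N) =
      (Real.exp (-(1 / N)) * Real.cos (u / N) : ℝ) +
        (Real.exp (-(1 / N)) * Real.sin (u / N) : ℝ) * Complex.I := by
  rw [show -(1 - u * Complex.I) / N = ((-(1 / N) : ℝ) : ℂ) + ((u / N : ℝ) : ℂ) * Complex.I by
    push_cast; ring, Complex.exp_add, Complex.exp_mul_I]
  push_cast
  ring

/-- With x = r e^{iθ}, |1 - x|² = (1 - r)² + 2r(1 - cos θ). After multiplication by N² the first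
term is at least 1/4 and the second at least 2u²/15. -/
lemma one_add_sq_le_norm_one_sub_exp {u : ℝ} {N : ℕ} (hN : 0 < N) (hu : |u| ≤ Real.pi * N) :
    (1 + u ^ 2) / 10 ≤ ‖(N : ℂ) * (1 - Complex.exp (-(1 - u * Complex.I) / N))‖ ^ 2 := by
  have hN' : (1 : ℝ) ≤ N := by exact_mod_cast hN
  have hN0 : (0 : ℝ) < N := by linarith
  set r := Real.exp (-(1 / N : ℝ)) with hr
  set θ := u / N with hθ
  have ht1 : (1 / N : ℝ) ≤ 1 := by rw [div_le_one hN0]; exact hN'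
  have ht0 : (0 : ℝ) < 1 / N := by positivity
  have hr1 : r ≤ 1 - (1 / N) / 2 := exp_neg_le_one_sub_half ht0.le ht1
  have hr3 : 1 / 3 ≤ r := by
    have h1 : Real.exp (-1) ≤ r := Real.exp_le_exp.2 (by linarith)
    have h2 : (1 / 3 : ℝ) ≤ Real.exp (-1) := by
      rw [Real.exp_neg, one_div]
      exact inv_anti₀ (Real.exp_pos 1) (by linarith [Real.exp_one_lt_d9])
    linarith
  have hcos : Real.cos θ ≤ 1 - 2 / Real.pi ^ 2 * θ ^ 2 := by
    apply Real.cos_le_one_sub_mul_cos_sq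
    rw [hθ, abs_div, abs_of_pos hN0, div_le_iff₀ hN0]
    exact hu
  have hpi : 1 / 5 ≤ 2 / Real.pi ^ 2 := by
    rw [div_le_div_iff₀ (by norm_num) (by positivity)]
    nlinarith [Real.pi_lt_d2, Real.pi_pos]
  have hnorm : ‖(N : ℂ) * (1 - Complex.exp (-(1 - u * Complex.I) / N))‖ ^ 2 =
      N ^ 2 * ((1 - r) ^ 2 + 2 * r * (1 - Real.cos θ)) := by
    rw [norm_mul, mul_pow, Complex.norm_natCast, exp_contour, ← hr, ← hθ, ← Complex.normSq_eq_norm_sq,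
      Complex.normSq_apply]
    simp only [Complex.sub_re, Complex.sub_im, Complex.add_re, Complex.add_im, Complex.one_re,
      Complex.one_im, Complex.re_ofReal_mul, Complex.im_ofReal_mul, Complex.ofReal_re,
      Complex.ofReal_im, Complex.I_re, Complex.I_im]
    linear_combination N ^ 2 * r ^ 2 * Real.sin_sq_add_cos_sq θ
  have hNθ : (N : ℝ) ^ 2 * θ ^ 2 = u ^ 2 := by
    rw [hθ]; field_simp
  have h1 : 1 / 4 ≤ (N : ℝ) ^ 2 * (1 - r) ^ 2 := by
    rw [← mul_pow]
    have : 1 / 2 ≤ N * (1 - r) := by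
      calc (1 / 2 : ℝ) = N * ((1 / N) / 2) := by field_simp
        _ ≤ N * (1 - r) := by gcongr; linarith
    nlinarith
  have h2 : θ ^ 2 / 5 ≤ 1 - Real.cos θ := by nlinarith [sq_nonneg θ]
  have h3 : 2 / 15 * θ ^ 2 ≤ 2 * r * (1 - Real.cos θ) := by nlinarith [sq_nonneg θ]
  have h4 : 2 / 15 * u ^ 2 ≤ (N : ℝ) ^ 2 * (2 * r * (1 - Real.cos θ)) := by
    rw [← hNθ]
    nlinarith [sq_nonneg (N : ℝ)]
  rw [hnorm]
  nlinarith [sq_nonneg u]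

/-- In the right half-plane Re(1 + x) ≥ 1. Otherwise |u| ≥ N, and the distance 1 - |x| ≥ 1/(2N) to
the unit circle suffices. -/
lemma one_le_mul_norm_one_add_exp {u : ℝ} {N : ℕ} (hN : 0 < N) :
    1 ≤ 2 * √(1 + u ^ 2) * ‖1 + Complex.exp (-(1 - u * Complex.I) / N)‖ := by
  have hN' : (1 : ℝ) ≤ N := by exact_mod_cast hN
  have hN0 : (0 : ℝ) < N := by linarith
  have hs1 : 1 ≤ √(1 + u ^ 2) := by
    rw [Real.one_le_sqrt]; nlinarith [sq_nonneg u]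
  by_cases hθ : |u / N| ≤ Real.pi / 2
  · have hcos : 0 ≤ Real.cos (u / N) := Real.cos_nonneg_of_mem_Icc (abs_le.1 hθ)
    have h1 : 1 ≤ ‖1 + Complex.exp (-(1 - u * Complex.I) / N)‖ := by
      refine le_trans ?_ (Complex.re_le_norm _)
      rw [exp_contour]
      simp only [Complex.add_re, Complex.one_re, Complex.re_ofReal_mul, Complex.ofReal_re,
        Complex.I_re]
      have := mul_nonneg (Real.exp_pos (-(1 / N : ℝ))).le hcos
      linarith
    nlinarith
  · have hu : (N : ℝ) ≤ |u| := by
      rw [not_le, abs_div, abs_of_pos hN0, lt_div_iff₀ hN0] at hθ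
      nlinarith [Real.pi_gt_three]
    have hs : |u| ≤ √(1 + u ^ 2) := Real.abs_le_sqrt (by linarith)
    have ht1 : (1 / N : ℝ) ≤ 1 := by rw [div_le_one hN0]; exact hN'
    have ht0 : (0 : ℝ) < 1 / N := by positivity
    have hr1 := exp_neg_le_one_sub_half ht0.le ht1
    have h1 : (1 / N : ℝ) / 2 ≤ ‖1 + Complex.exp (-(1 - u * Complex.I) / N)‖ := by
      have := norm_sub_norm_le (1 : ℂ) (-Complex.exp (-(1 - u * Complex.I) / N))
      rw [norm_neg, norm_exp_contour, norm_one, sub_neg_eq_add] at this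
      linarith
    calc (1 : ℝ) = 2 * N * ((1 / N) / 2) := by field_simp
      _ ≤ 2 * √(1 + u ^ 2) * ‖1 + Complex.exp (-(1 - u * Complex.I) / N)‖ := by
        gcongr
        linarith

/-- The Cayley transform maps the unit disc to the right half-plane; at x = -1 the quotient is 0 by
convention. -/
lemma re_one_sub_div_one_add_nonneg {x : ℂ} (hx : ‖x‖ ≤ 1) : 0 ≤ ((1 - x) / (1 + x)).re := by
  rw [Complex.div_re, ← add_div]
  refine div_nonneg ?_ (Complex.normSq_nonneg _)
  have h : Complex.normSq x ≤ 1 := by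
    rw [Complex.normSq_eq_norm_sq]
    exact pow_le_one₀ (norm_nonneg x) hx
  rw [Complex.normSq_apply] at h
  simp only [Complex.sub_re, Complex.sub_im, Complex.add_re, Complex.add_im, Complex.one_re,
    Complex.one_im]
  nlinarith

end Contour

/-! ### Dominated convergence for the rescaled contour integral. -/

section Asymptotics

/-- The logarithm of the rescaled integrand of the contour integral, where `s` is the centre of
the spectral parameters and `x = exp (-(1 - iu) / N)`. -/
noncomputable def contourExponent (b η : ℂ) (s : ℝ) (N : ℕ) (u : ℝ) : ℂ :=
  (b - 3) / 2 * Complex.exp (-(1 - u * Complex.I) / N) ^ 2 -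
    5 / 2 * Complex.log (N * (1 - Complex.exp (-(1 - u * Complex.I) / N))) -
    1 / 2 * Complex.log (1 + Complex.exp (-(1 - u * Complex.I) / N)) -
    (s ^ 2 / N : ℝ) / 2 * ((N * (1 - Complex.exp (-(1 - u * Complex.I) / N))) /
      (1 + Complex.exp (-(1 - u * Complex.I) / N))) -
    η ^ 2 * Complex.exp (-(1 - u * Complex.I) / N) /
      (N * (1 - Complex.exp (-(1 - u * Complex.I) / N))) +
    (1 - u * Complex.I)

/-- The pointwise limit of `contourExponent`. -/
noncomputable def limitExponent (b η : ℂ) (ξ : ℝ) (u : ℝ) : ℂ :=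
  (b - 3) / 2 - 5 / 2 * Complex.log (1 - u * Complex.I) - 1 / 2 * Complex.log 2 -
    (ξ ^ 2 : ℝ) / 2 * ((1 - u * Complex.I) / 2) - η ^ 2 / (1 - u * Complex.I) +
    (1 - u * Complex.I)

/-- The factor N^(-5/2) turns (1 - x)^(-5/2) into (N(1 - x))^(-5/2). Since x/(1 + x) = 1/2 - (1 -
x)/(2(1 + x)), the factor exp(-s²/2) cancels the part of the exponent growing with s. -/
lemma genFun_mul_exp_eq (b η : ℂ) (s : ℝ) {N : ℕ} (hN : 0 < N) (u : ℝ) :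
    (N : ℂ) ^ (-(5 / 2) : ℂ) * Complex.exp (-(s : ℂ) ^ 2 / 2) *
      (genFun b (s + η / (√(N : ℝ) : ℂ)) (s - η / (√(N : ℝ) : ℂ))
        (Complex.exp (-(1 - u * Complex.I) / N)) * Complex.exp (1 - u * Complex.I)) =
      Complex.exp (contourExponent b η s N u) := by
  have hN0 : (0 : ℝ) < N := by exact_mod_cast hN
  have hNc : (N : ℂ) ≠ 0 := by exact_mod_cast hN.ne'
  have hx : ‖Complex.exp (-(1 - u * Complex.I) / N)‖ < 1 := by
    rw [norm_exp_contour, Real.exp_lt_one_iff]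
    simpa using hN
  have h1 := Complex.slitPlane_ne_zero (one_sub_mem_slitPlane hx)
  have h2 := Complex.slitPlane_ne_zero (one_add_mem_slitPlane hx)
  have hsq : (√(N : ℝ) : ℂ) ^ 2 = N := by
    rw [← Complex.ofReal_pow, Real.sq_sqrt hN0.le]
    simp
  have hs0 : (√(N : ℝ) : ℂ) ≠ 0 := by
    intro h
    rw [h] at hsq
    exact hNc (by rw [← hsq]; simp)
  have hlog : Complex.log (N * (1 - Complex.exp (-(1 - u * Complex.I) / N))) =
      Complex.log N + Complex.log (1 - Complex.exp (-(1 - u * Complex.I) / N)) := by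
    have := Complex.log_ofReal_mul hN0 h1
    rwa [Complex.ofReal_log hN0.le, Complex.ofReal_natCast] at this
  rw [contourExponent, hlog, Complex.cpow_def_of_ne_zero hNc, genFun, ← Complex.exp_add,
    ← Complex.exp_add, ← Complex.exp_add]
  congr 1
  generalize Complex.exp (-(1 - u * Complex.I) / N) = x at *
  have h3 : 1 - x ^ 2 ≠ 0 := by
    rw [show 1 - x ^ 2 = (1 - x) * (1 + x) by ring]
    exact mul_ne_zero h1 h2
  have hprod : (s + η / (√(N : ℝ) : ℂ)) * (s - η / (√(N : ℝ) : ℂ)) = s ^ 2 - η ^ 2 / N := by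
    rw [← hsq]
    field_simp
    ring
  have hsum : (s + η / (√(N : ℝ) : ℂ)) ^ 2 + (s - η / (√(N : ℝ) : ℂ)) ^ 2 =
      2 * s ^ 2 + 2 * (η ^ 2 / N) := by
    rw [← hsq]
    field_simp
    ring
  have hkey : ((s ^ 2 - η ^ 2 / N) * x - (2 * s ^ 2 + 2 * (η ^ 2 / N)) / 2 * x ^ 2) / (1 - x ^ 2) =
      (s : ℂ) ^ 2 / 2 - (s ^ 2 / N : ℝ) / 2 * ((N * (1 - x)) / (1 + x)) -
        η ^ 2 * x / (N * (1 - x)) := by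
    rw [show 1 - x ^ 2 = (1 - x) * (1 + x) by ring]
    push_cast
    field_simp
    ring
  rw [hprod, hsum, hkey]
  ring

lemma tendsto_exp_contour (u : ℝ) :
    Tendsto (fun N : ℕ => Complex.exp (-(1 - u * Complex.I) / N)) atTop (𝓝 1) := by
  have h : Tendsto (fun N : ℕ => -(1 - u * Complex.I) / (N : ℂ)) atTop (𝓝 0) :=
    tendsto_const_div_atTop_nhds_zero_nat _
  have h' := (Complex.continuous_exp.tendsto 0).comp h
  rwa [Complex.exp_zero] at h'

/-- This is the difference quotient of t ↦ exp(-zt) at 0 along t = 1/N, with the sign changed. -/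
lemma tendsto_nat_mul_one_sub_exp (z : ℂ) :
    Tendsto (fun N : ℕ => (N : ℂ) * (1 - Complex.exp (-z / N))) atTop (𝓝 z) := by
  have h1 : HasDerivAt (fun t : ℂ => Complex.exp (-z * t)) (-z) 0 := by
    simpa using ((hasDerivAt_id' (0 : ℂ)).const_mul (-z)).cexp
  have h2 : Tendsto (fun N : ℕ => ((N : ℂ))⁻¹) atTop (𝓝[≠] 0) := by
    rw [tendsto_nhdsWithin_iff]
    refine ⟨tendsto_inv_atTop_nhds_zero_nat, ?_⟩
    filter_upwards [eventually_gt_atTop 0] with N hN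
    simpa using hN.ne'
  have h3 := (h1.tendsto_slope_zero.comp h2).neg
  rw [neg_neg] at h3
  refine h3.congr fun N => ?_
  simp only [Function.comp_apply, inv_inv, smul_eq_mul, zero_add, mul_zero, Complex.exp_zero]
  rw [← div_eq_mul_inv]
  ring

lemma tendsto_contourExponent (b η : ℂ) {s : ℕ → ℝ} {ξ : ℝ}
    (hs : Tendsto (fun N : ℕ => s N / √(N : ℝ)) atTop (𝓝 ξ)) (u : ℝ) :
    Tendsto (fun N : ℕ => contourExponent b η (s N) N u) atTop (𝓝 (limitExponent b η ξ u)) := by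
  have hx := tendsto_exp_contour u
  have hz := tendsto_nat_mul_one_sub_exp (1 - u * Complex.I)
  have hre : (0 : ℝ) < (1 - u * Complex.I).re := by simp
  have hz0 : (1 - u * Complex.I) ≠ 0 := fun h => by simp [h] at hre
  have hs2 : Tendsto (fun N : ℕ => s N ^ 2 / N) atTop (𝓝 (ξ ^ 2)) := by
    refine (hs.pow 2).congr fun N => ?_
    rw [div_pow, Real.sq_sqrt (Nat.cast_nonneg N)]
  have hs2' : Tendsto (fun N : ℕ => ((s N ^ 2 / N : ℝ) : ℂ)) atTop (𝓝 ((ξ ^ 2 : ℝ) : ℂ)) :=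
    (Complex.continuous_ofReal.tendsto _).comp hs2
  have h1 := (hx.pow 2).const_mul ((b - 3) / 2)
  have h2 := (hz.clog (Or.inl hre)).const_mul (5 / 2)
  have h11 : (1 : ℂ) + 1 = 2 := by norm_num
  have hx1 : Tendsto (fun N : ℕ => 1 + Complex.exp (-(1 - u * Complex.I) / N)) atTop (𝓝 2) := by
    simpa only [h11] using hx.const_add 1
  have h3 := (hx1.clog (by simp [Complex.slitPlane])).const_mul (1 / 2)
  have h4 := (hs2'.div_const 2).mul (hz.div hx1 two_ne_zero)
  have h5 := (hx.const_mul (η ^ 2)).div hz hz0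
  have := ((((h1.sub h2).sub h3).sub h4).sub h5).add_const (1 - u * Complex.I)
  simpa only [contourExponent, limitExponent, one_pow, mul_one, Pi.div_apply] using this

/-- This provides the dominating function: (1 + u²)^(-5/4) from N(1 - x) times (1 + u²)^(1/4) from 1
+ x gives the integrable (1 + u²)^(-1). The term containing s only lowers the real part, so the
bound is uniform in s. -/
lemma contourExponent_re_le (b η : ℂ) (s : ℝ) {N : ℕ} (hN : 0 < N) {u : ℝ}
    (hu : |u| ≤ Real.pi * N) :
    (contourExponent b η s N u).re ≤ ‖(b - 3) / 2‖ + 5 / 4 * Real.log 10 + 1 / 2 * Real.log 2 +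
      4 * ‖η‖ ^ 2 + 1 - Real.log (1 + u ^ 2) := by
  have hN0 : (0 : ℝ) < N := by exact_mod_cast hN
  have hA := one_add_sq_le_norm_one_sub_exp hN hu
  have hB := one_le_mul_norm_one_add_exp (u := u) hN
  have hx : ‖Complex.exp (-(1 - u * Complex.I) / N)‖ ≤ 1 := by
    rw [norm_exp_contour, Real.exp_le_one_iff]
    simp
  have h1u : 0 < 1 + u ^ 2 := by positivity
  rw [contourExponent]
  generalize Complex.exp (-(1 - u * Complex.I) / N) = x at *
  set y : ℂ := N * (1 - x) with hy
  have hy0 : 0 < ‖y‖ := by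
    rw [norm_pos_iff]
    rintro h
    rw [h, norm_zero] at hA
    nlinarith
  have hx0 : 0 < ‖1 + x‖ := by
    rw [norm_pos_iff]
    rintro h
    rw [h, norm_zero] at hB
    linarith
  have e1 : ((b - 3) / 2 * x ^ 2).re ≤ ‖(b - 3) / 2‖ := by
    refine (Complex.re_le_norm _).trans ?_
    rw [norm_mul, norm_pow]
    exact mul_le_of_le_one_right (norm_nonneg _) (pow_le_one₀ (norm_nonneg _) hx)
  have e2 : Real.log (1 + u ^ 2) - Real.log 10 ≤ 2 * Real.log ‖y‖ := by
    have := Real.log_le_log (by positivity) hA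
    rwa [Real.log_div h1u.ne' (by norm_num), Real.log_pow] at this
  have e3 : 0 ≤ Real.log 2 + 1 / 2 * Real.log (1 + u ^ 2) + Real.log ‖1 + x‖ := by
    have := Real.log_le_log one_pos hB
    have hsq : 0 < √(1 + u ^ 2) := Real.sqrt_pos.2 h1u
    rw [Real.log_one, Real.log_mul (by positivity) hx0.ne', Real.log_mul (by norm_num) hsq.ne',
      Real.log_sqrt h1u.le] at this
    linarith
  have e4 : 0 ≤ ((s ^ 2 / N : ℝ) / 2 * (y / (1 + x)) : ℂ).re := by
    have : ((s ^ 2 / N : ℝ) / 2 * (y / (1 + x)) : ℂ) =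
        ((s ^ 2 / N / 2 * N : ℝ) : ℂ) * ((1 - x) / (1 + x)) := by
      rw [hy]; push_cast; ring
    rw [this, Complex.re_ofReal_mul]
    exact mul_nonneg (by positivity) (re_one_sub_div_one_add_nonneg hx)
  have e5 : -(η ^ 2 * x / y).re ≤ 4 * ‖η‖ ^ 2 := by
    refine (neg_le_abs _).trans ((Complex.abs_re_le_norm _).trans ?_)
    rw [norm_div, norm_mul, norm_pow, div_le_iff₀ hy0]
    -- From ‖y‖² ≥ 1/10 > 1/16; this is the source of the constant 4‖η‖².
    have h14 : 1 / 4 ≤ ‖y‖ := by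
      by_contra h
      push Not at h
      nlinarith [sq_nonneg u]
    have : ‖η‖ ^ 2 * ‖x‖ ≤ ‖η‖ ^ 2 := mul_le_of_le_one_right (by positivity) hx
    nlinarith [sq_nonneg ‖η‖]
  have r1 : (5 / 2 * Complex.log y).re = 5 / 2 * Real.log ‖y‖ := by
    rw [show (5 / 2 : ℂ) = ((5 / 2 : ℝ) : ℂ) by push_cast; rfl, Complex.re_ofReal_mul,
      Complex.log_re]
  have r2 : (1 / 2 * Complex.log (1 + x)).re = 1 / 2 * Real.log ‖1 + x‖ := by
    rw [show (1 / 2 : ℂ) = ((1 / 2 : ℝ) : ℂ) by push_cast; rfl, Complex.re_ofReal_mul,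
      Complex.log_re]
  have r3 : (1 - u * Complex.I).re = 1 := by simp
  simp only [Complex.add_re, Complex.sub_re] at r3 ⊢
  rw [r1, r2, r3]
  linarith

lemma measurable_contourExponent (b η : ℂ) (s : ℝ) (N : ℕ) :
    Measurable (contourExponent b η s N) := by
  unfold contourExponent
  fun_prop

/-- Asymptotics of the Taylor coefficients of the generating function. -/
lemma tendsto_taylorCoef_genFun (b η : ℂ) {s : ℕ → ℝ} {ξ : ℝ}
    (hs : Tendsto (fun N : ℕ => s N / √(N : ℝ)) atTop (𝓝 ξ)) :
    Tendsto (fun N : ℕ => ((√(2 * Real.pi / (N : ℝ) ^ 3) * Real.exp (-(s N) ^ 2 / 2) : ℝ) : ℂ) *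
        taylorCoef (genFun b (s N + η / (√(N : ℝ) : ℂ)) (s N - η / (√(N : ℝ) : ℂ))) N)
      atTop (𝓝 (1 / √(2 * Real.pi) * ∫ u : ℝ, Complex.exp (limitExponent b η ξ u))) := by
  set C : ℝ := ‖(b - 3) / 2‖ + 5 / 4 * Real.log 10 + 1 / 2 * Real.log 2 +
      4 * ‖η‖ ^ 2 + 1 with hC
  have hdom : Tendsto (fun N : ℕ => ∫ u : ℝ, (Set.Ioc (-(Real.pi * N)) (Real.pi * N)).indicator
      (fun u => Complex.exp (contourExponent b η (s N) N u)) u) atTop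
      (𝓝 (∫ u : ℝ, Complex.exp (limitExponent b η ξ u))) := by
    refine tendsto_integral_filter_of_dominated_convergence
      (fun u => Real.exp C * (1 + u ^ 2)⁻¹) ?_ ?_ (integrable_inv_one_add_sq.const_mul _) ?_
    · refine Eventually.of_forall fun N => ?_
      exact ((measurable_contourExponent b η (s N) N).cexp.indicator
        measurableSet_Ioc).aestronglyMeasurable
    · filter_upwards [eventually_gt_atTop 0] with N hN
      refine Eventually.of_forall fun u => ?_
      rw [Set.indicator_apply]
      split_ifs with hu
      · rw [Complex.norm_exp]
        have h := contourExponent_re_le b η (s N) hN (abs_le.2 ⟨hu.1.le, hu.2⟩)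
        rw [← hC] at h
        refine (Real.exp_le_exp.2 h).trans_eq ?_
        rw [Real.exp_sub, Real.exp_log (by positivity), div_eq_mul_inv]
      · rw [norm_zero]
        positivity
    · refine Eventually.of_forall fun u => ?_
      have h := (tendsto_contourExponent b η hs u).cexp
      refine h.congr' ?_
      have hN : Tendsto (fun N : ℕ => Real.pi * (N : ℝ)) atTop atTop :=
        tendsto_natCast_atTop_atTop.const_mul_atTop Real.pi_pos
      filter_upwards [hN.eventually_gt_atTop |u|] with N hN
      rw [Set.indicator_of_mem]
      exact ⟨(abs_lt.1 hN).1, (abs_lt.1 hN).2.le⟩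
  refine (hdom.const_mul (1 / (√(2 * Real.pi) : ℂ))).congr' ?_
  filter_upwards [eventually_gt_atTop 0] with N hN
  have hN0 : (0 : ℝ) < N := by exact_mod_cast hN
  have hNc : (N : ℂ) ≠ 0 := by exact_mod_cast hN.ne'
  rw [integral_indicator measurableSet_Ioc, ← intervalIntegral.integral_of_le (by
    have := Real.pi_pos; nlinarith), taylorCoef_eq_integral (differentiableOn_genFun _ _ _) hN]
  simp only [← genFun_mul_exp_eq b η (s N) hN]
  rw [intervalIntegral.integral_const_mul]
  have hpow : (N : ℂ) ^ (-(5 / 2) : ℂ) = (((N : ℝ) ^ (-(5 / 2) : ℝ) : ℝ) : ℂ) := by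
    rw [Complex.ofReal_cpow hN0.le]
    push_cast
    rfl
  -- The N^(-3/2) of the normalization and the 1/N of the rescaled angle combine to the N^(-5/2)
  -- required by the singularity at 1.
  have hreal : √(2 * Real.pi / (N : ℝ) ^ 3) * (1 / (2 * Real.pi * N)) =
      1 / √(2 * Real.pi) * (N : ℝ) ^ (-(5 / 2) : ℝ) := by
    have h5 : (N : ℝ) ^ (-(5 / 2) : ℝ) = 1 / (N * √((N : ℝ) ^ 3)) := by
      rw [Real.rpow_neg hN0.le, one_div, Real.sqrt_eq_rpow, ← Real.rpow_natCast,
        ← Real.rpow_mul hN0.le]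
      congr 1
      nth_rewrite 2 [← Real.rpow_one (N : ℝ)]
      rw [← Real.rpow_add hN0]
      norm_num
    have h2pi : 0 < 2 * Real.pi := by positivity
    have h6 : √(2 * Real.pi) * √(2 * Real.pi) = 2 * Real.pi := Real.mul_self_sqrt h2pi.le
    have h7 : 0 < √(2 * Real.pi) := Real.sqrt_pos.2 h2pi
    have h8 : 0 < √((N : ℝ) ^ 3) := Real.sqrt_pos.2 (by positivity)
    rw [h5, Real.sqrt_div h2pi.le]
    rw [div_mul_div_comm, div_mul_div_comm, div_eq_div_iff (by positivity) (by positivity)]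
    linear_combination ↑N * √((N : ℝ) ^ 3) * h6
  have hrealc := congrArg (fun t : ℝ => (t : ℂ)) hreal
  push_cast at hrealc
  rw [hpow]
  push_cast
  rw [show ∀ e c I₀ : ℂ, 1 / (√(2 * Real.pi) : ℂ) * (c * e * I₀) =
    (1 / (√(2 * Real.pi) : ℂ) * c) * e * I₀ by intros; ring, ← hrealc]
  ring

end Asymptotics

/-! ### Evaluation of the limiting integral. -/

section Hankel

lemma hasSum_limitT (z : ℂ) :
    HasSum (fun k : ℕ => (-1) ^ k * z ^ (2 * k) * ((k + 1) / (2 * k + 3).factorial)) (limitT z) := by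
  rcases eq_or_ne z 0 with rfl | hz
  · have h := hasSum_single (f := fun k : ℕ =>
      (-1 : ℂ) ^ k * 0 ^ (2 * k) * ((k + 1) / (2 * k + 3).factorial)) 0
      (fun k hk => by simp [hk])
    convert! h using 1
    simp [limitT, Nat.factorial]
  · have h1 := (Complex.hasSum_sin z).div_const (z ^ 3)
    have h2 := (Complex.hasSum_cos z).div_const (z ^ 2)
    have h3 := (h1.sub h2).mul_left (1 / 2)
    rw [limitT, if_neg hz]
    -- The terms of index 0 are both 1/z² and cancel. After the shift, (1/(2k + 2)! - 1/(2k + 3)!)/2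
    -- = (k + 1)/(2k + 3)!.
    rw [← hasSum_nat_add_iff' 1] at h3
    simp only [Finset.range_one, Finset.sum_singleton] at h3
    convert! h3 using 1
    · funext k
      have e1 : 2 * (k + 1) + 1 = 2 * k + 2 + 1 := by ring
      have e2 : 2 * (k + 1) = 2 * k + 1 + 1 := by ring
      have e3 : 2 * k + 3 = 2 * k + 2 + 1 := rfl
      have hf : ((2 * k + 1 + 1).factorial : ℂ) ≠ 0 := by exact_mod_cast Nat.factorial_ne_zero _
      have hk : (2 * k + 3 : ℂ) ≠ 0 := by exact_mod_cast Nat.succ_ne_zero (2 * k + 2)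
      rw [e1, e2, e3, Nat.factorial_succ (2 * k + 2)]
      push_cast
      obtain ⟨c, hc⟩ : ∃ c : ℂ, c = 2 * k + 3 := ⟨_, rfl⟩
      rw [show (2 * k + 2 + 1 : ℂ) = c by rw [hc]; ring]
      rw [← hc] at hk
      field_simp
      rw [hc]
      ring
    · simp only [pow_zero, mul_zero, zero_add, pow_one, one_mul, Nat.factorial_one,
        Nat.factorial_zero, Nat.cast_one, div_one]
      field_simp
      ring

/-- Legendre's duplication formula for Γ(k + 2)Γ(k + 5/2), with Γ(k + 2) = (k + 1) k!, by induction
from Γ(5/2) = 3√π/4. -/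
lemma gamma_duplication (k : ℕ) :
    (k.factorial : ℝ) * Real.Gamma (k + 5 / 2) * (8 * 4 ^ k * (k + 1)) =
      √Real.pi * (2 * k + 3).factorial := by
  induction k with
  | zero =>
    have h1 : Real.Gamma (5 / 2) = 3 / 2 * (1 / 2 * √Real.pi) := by
      rw [show (5 / 2 : ℝ) = 3 / 2 + 1 by norm_num, Real.Gamma_add_one (by norm_num),
        show (3 / 2 : ℝ) = 1 / 2 + 1 by norm_num, Real.Gamma_add_one (by norm_num),
        Real.Gamma_one_half_eq]
    simp only [Nat.cast_zero, zero_add, h1, Nat.factorial_zero, mul_zero]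
    norm_num [Nat.factorial]
    ring
  | succ k ih =>
    have h0 : (k : ℝ) + 5 / 2 ≠ 0 := by positivity
    rw [show ((k + 1 : ℕ) : ℝ) + 5 / 2 = (k + 5 / 2) + 1 by push_cast; ring,
      Real.Gamma_add_one h0, Nat.factorial_succ, show 2 * (k + 1) + 3 = 2 * k + 3 + 1 + 1 by ring,
      Nat.factorial_succ, Nat.factorial_succ]
    push_cast
    have hk : (k : ℝ) + 1 ≠ 0 := by positivity
    linear_combination (2 * (k : ℝ) + 5) * (2 * k + 4) * ih

lemma integral_gammaMeasure_one {E : Type*} [NormedAddCommGroup E] [NormedSpace ℝ E] {s : ℝ}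
    (hs : 0 < s) (f : ℝ → E) :
    ∫ x, f x ∂gammaMeasure s 1 = ∫ x, gammaPDFReal s 1 x • f x := by
  have hm : Measurable (gammaPDF s 1) := (measurable_gammaPDFReal s 1).ennreal_ofReal
  rw [gammaMeasure, integral_withDensity_eq_integral_toReal_smul hm
    (Eventually.of_forall fun x => by simp [gammaPDF])]
  congr with x
  rw [gammaPDF, ENNReal.toReal_ofReal (gammaPDFReal_nonneg hs one_pos x)]

lemma mgf_gammaMeasure_one {s t : ℝ} (hs : 0 < s) (ht : t < 1) :
    mgf id (gammaMeasure s 1) t = Real.exp (-s * Real.log (1 - t)) := by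
  have ht' : 0 < 1 - t := by linarith
  have h : ∀ x ∈ Set.Ici (0 : ℝ), gammaPDFReal s 1 x * Real.exp (t * x) =
      (Real.Gamma s)⁻¹ * (x ^ (s - 1) * Real.exp (-((1 - t) * x))) := by
    intro x hx
    rw [gammaPDFReal, if_pos (Set.mem_Ici.1 hx), Real.one_rpow, one_div,
      show -((1 - t) * x) = -(1 * x) + t * x by ring, Real.exp_add]
    ring
  have h0 : (Set.Ici (0 : ℝ)).indicator (fun x => gammaPDFReal s 1 x * Real.exp (t * x)) =
      fun x => gammaPDFReal s 1 x * Real.exp (t * x) := by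
    rw [Set.indicator_eq_self]
    intro x hx
    by_contra hneg
    simp [gammaPDFReal, show ¬ 0 ≤ x from hneg] at hx
  rw [mgf, integral_gammaMeasure_one hs]
  simp only [smul_eq_mul, id]
  rw [← h0, integral_indicator measurableSet_Ici, setIntegral_congr_fun measurableSet_Ici h,
    integral_Ici_eq_integral_Ioi, integral_const_mul,
    Real.integral_rpow_mul_exp_neg_mul_Ioi hs ht', Real.rpow_def_of_pos (by positivity),
    one_div, Real.log_inv]
  have := (Real.Gamma_pos_of_pos hs).ne'
  field_simp

/-- The moment generating function of the gamma distribution on the half-plane `re z < 1`. -/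
lemma complexMGF_gammaMeasure_one {s : ℝ} (hs : 0 < s) {z : ℂ} (hz : z.re < 1) :
    complexMGF id (gammaMeasure s 1) z = Complex.exp (-s * Complex.log (1 - z)) := by
  have hset : Set.Iio (1 : ℝ) ⊆ integrableExpSet id (gammaMeasure s 1) := by
    intro t ht
    refine Integrable.of_integral_ne_zero ?_
    have h := mgf_gammaMeasure_one hs ht
    rw [mgf] at h
    rw [h]
    exact (Real.exp_pos _).ne'
  have hint : Set.Iio (1 : ℝ) ⊆ interior (integrableExpSet id (gammaMeasure s 1)) :=
    interior_maximal hset isOpen_Iio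
  have hslit : ∀ z : ℂ, z.re < 1 → 1 - z ∈ Complex.slitPlane := by
    intro z hz
    left
    simpa using hz
  have ha1 : AnalyticOnNhd ℂ (complexMGF id (gammaMeasure s 1)) {z | z.re < 1} :=
    fun z hz => analyticAt_complexMGF (hint hz)
  have ha2 : AnalyticOnNhd ℂ (fun z => Complex.exp (-s * Complex.log (1 - z))) {z | z.re < 1} :=
    fun z hz => (analyticAt_const.mul ((analyticAt_const.sub analyticAt_id).clog (hslit z hz))).cexp
  have hconn : IsPreconnected {z : ℂ | z.re < 1} := (convex_halfSpace_re_lt 1).isPreconnected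
  -- Identity theorem: both sides are analytic on the half-plane and agree at the real points -1/(n
  -- + 1), which accumulate at 0.
  refine ha1.eqOn_of_preconnected_of_frequently_eq ha2 hconn (z₀ := 0) (by simp) ?_ hz
  have hlim : Tendsto (fun n : ℕ => ((-(1 / ((n : ℝ) + 1)) : ℝ) : ℂ)) atTop (𝓝[≠] 0) := by
    rw [tendsto_nhdsWithin_iff]
    constructor
    · have := tendsto_one_div_add_atTop_nhds_zero_nat (𝕜 := ℝ)
      have := (Complex.continuous_ofReal.tendsto _).comp this.neg
      simpa [Function.comp_def] using this
    · refine Eventually.of_forall fun n => ?_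
      have : (n : ℝ) + 1 ≠ 0 := by positivity
      simpa using by exact_mod_cast this
  refine hlim.frequently (Eventually.of_forall fun n => ?_).frequently
  have hn : -(1 / ((n : ℝ) + 1)) < 1 := by
    have : 0 < 1 / ((n : ℝ) + 1) := by positivity
    linarith
  rw [complexMGF_ofReal, mgf_gammaMeasure_one hs hn, Complex.ofReal_exp, Complex.ofReal_mul,
    Complex.ofReal_log (by linarith)]
  push_cast
  rfl

/-- Here |1 - iu| ≥ 1, so |1 - iu|^(-s) ≤ |1 - iu|^(-2) for s ≥ 2. -/
lemma norm_exp_neg_mul_log_le {s : ℝ} (hs : 2 ≤ s) (u : ℝ) :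
    ‖Complex.exp (-s * Complex.log (1 - u * Complex.I))‖ ≤ (1 + u ^ 2)⁻¹ := by
  have h1 : 0 < 1 + u ^ 2 := by positivity
  have hn : Real.log ‖1 - u * Complex.I‖ = 1 / 2 * Real.log (1 + u ^ 2) := by
    rw [Complex.norm_def, Real.log_sqrt (Complex.normSq_nonneg _), Complex.normSq_apply]
    simp only [Complex.sub_re, Complex.one_re, Complex.re_ofReal_mul, Complex.I_re, Complex.sub_im,
      Complex.one_im, Complex.im_ofReal_mul, Complex.I_im]
    ring_nf
  rw [Complex.norm_exp, ← Complex.ofReal_neg, Complex.re_ofReal_mul, Complex.log_re, hn,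
    ← Real.exp_log (inv_pos.2 h1), Real.log_inv]
  apply Real.exp_le_exp.2
  have : 0 ≤ Real.log (1 + u ^ 2) := Real.log_nonneg (by nlinarith [sq_nonneg u])
  nlinarith

lemma integrable_exp_neg_mul_log {s : ℝ} (hs : 2 ≤ s) (a : ℝ) :
    Integrable fun u : ℝ => Complex.exp (-s * Complex.log (1 - u * Complex.I) +
      a * (1 - u * Complex.I)) := by
  refine (integrable_inv_one_add_sq.const_mul (Real.exp a)).mono' (by fun_prop) ?_
  refine Eventually.of_forall fun u => ?_
  rw [Complex.exp_add, norm_mul, mul_comm, Complex.norm_exp (a * _)]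
  have : (a * (1 - u * Complex.I) : ℂ).re = a := by simp
  rw [this]
  gcongr
  exact norm_exp_neg_mul_log_le hs u

/-- Hankel's formula for the reciprocal of the Gamma function, on a vertical line. -/
lemma integral_exp_neg_mul_log {s a : ℝ} (hs : 2 ≤ s) (ha : 0 < a) :
    ∫ u : ℝ, Complex.exp (-s * Complex.log (1 - u * Complex.I) + a * (1 - u * Complex.I)) =
      ((2 * Real.pi * (a ^ (s - 1) / Real.Gamma s) : ℝ) : ℂ) := by
  have hs0 : 0 < s := by linarith
  have hpi := Real.pi_pos
  set g : ℝ → ℂ := fun x => (gammaPDFReal s 1 x : ℂ) with hg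
  have hgint : Integrable g := by
    have h := mgf_gammaMeasure_one hs0 zero_lt_one
    rw [mgf, integral_gammaMeasure_one hs0] at h
    simp only [zero_mul, Real.exp_zero, smul_eq_mul, mul_one] at h
    have hint : Integrable (gammaPDFReal s 1) :=
      Integrable.of_integral_ne_zero (by rw [h]; exact (Real.exp_pos _).ne')
    exact hint.ofReal
  -- The Fourier transform of the gamma density is (1 + 2πiw)^(-s).
  have hF : FourierTransform.fourier g = fun w : ℝ =>
      Complex.exp (-s * Complex.log (1 - (-2 * Real.pi * w : ℝ) * Complex.I)) := by
    funext w
    rw [← complexMGF_gammaMeasure_one hs0 (z := (-2 * Real.pi * w : ℝ) * Complex.I) (by simp),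
      complexMGF, integral_gammaMeasure_one hs0, Real.fourier_real_eq_integral_exp_smul]
    congr with x
    rw [smul_eq_mul, mul_comm, Complex.real_smul]
    simp only [hg, id]
    congr 2
    push_cast
    ring
  have hFint : Integrable (FourierTransform.fourier g) := by
    rw [hF]
    have h := (integrable_exp_neg_mul_log hs 0).comp_mul_left' (R := -2 * Real.pi)
      (by nlinarith)
    simpa using h
  have hcont : ContinuousAt g a := by
    have : g =ᶠ[𝓝 a] fun x => ((1 ^ s / Real.Gamma s * x ^ (s - 1) * Real.exp (-(1 * x)) : ℝ) : ℂ) := by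
      filter_upwards [lt_mem_nhds ha] with x hx
      simp only [hg, gammaPDFReal, if_pos hx.le]
    refine ContinuousAt.congr ?_ this.symm
    refine Complex.continuous_ofReal.continuousAt.comp ?_
    refine ContinuousAt.mul (continuousAt_const.mul
      (Real.continuousAt_rpow_const _ _ (Or.inl ha.ne'))) (by fun_prop)
  -- Fourier inversion at the point a, where the density is continuous since a > 0. Multiplying by
  -- exp(a) and substituting u = -2πw gives Hankel's integral.
  have hinv := hgint.fourierInv_fourier_eq hFint hcont
  rw [hF, Real.fourierInv_eq'] at hinv
  set G : ℝ → ℂ := fun u => Complex.exp (-s * Complex.log (1 - u * Complex.I) +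
    a * (1 - u * Complex.I)) with hG
  have hcomp := Measure.integral_comp_mul_left G (-2 * Real.pi)
  have hval : ∫ v : ℝ, G (-2 * Real.pi * v) = Complex.exp a * g a := by
    rw [← hinv, ← integral_const_mul]
    congr with v
    simp only [hG, smul_eq_mul]
    rw [← Complex.exp_add, ← Complex.exp_add]
    congr 1
    simp only [RCLike.inner_apply, conj_trivial]
    push_cast
    ring
  rw [hval] at hcomp
  have habs : |(-2 * Real.pi)⁻¹| = (2 * Real.pi)⁻¹ := by
    rw [abs_inv, neg_mul, abs_neg, abs_of_pos (by positivity)]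
  rw [habs, Complex.real_smul] at hcomp
  have hga : Complex.exp a * g a = ((a ^ (s - 1) / Real.Gamma s : ℝ) : ℂ) := by
    simp only [hg, gammaPDFReal, if_pos ha.le]
    rw [← Complex.ofReal_exp, ← Complex.ofReal_mul, Real.one_rpow, one_mul, Real.exp_neg]
    congr 1
    have := (Real.exp_pos a).ne'
    field_simp
  rw [hga] at hcomp
  rw [Complex.ofReal_mul, hcomp]
  have : (Real.pi : ℂ) ≠ 0 := by exact_mod_cast hpi.ne'
  push_cast
  field_simp

/-- Matches the k-th Hankel term with the k-th coefficient of `limitT` at √(4a) η, by means of the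
duplication formula. -/
lemma coefficient_identity {a : ℝ} (ha : 0 < a) (k : ℕ) :
    1 / √(2 * Real.pi) * (√2)⁻¹ * (1 / k.factorial) *
        (2 * Real.pi * (a ^ ((5 / 2 + k : ℝ) - 1) / Real.Gamma (5 / 2 + k))) =
      (4 * a) ^ (3 / 2 : ℝ) * ((4 * a) ^ k * ((k + 1) / (2 * k + 3).factorial)) := by
  have hpi := Real.pi_pos
  have hdup := gamma_duplication k
  rw [add_comm (k : ℝ) (5 / 2)] at hdup
  have hG : 0 < Real.Gamma (5 / 2 + k) := Real.Gamma_pos_of_pos (by positivity)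
  have hf : (0 : ℝ) < k.factorial := by exact_mod_cast k.factorial_pos
  have hf' : (0 : ℝ) < (2 * k + 3).factorial := by exact_mod_cast Nat.factorial_pos _
  have h1 : a ^ ((5 / 2 + k : ℝ) - 1) = a ^ k * a ^ (3 / 2 : ℝ) := by
    rw [show (5 / 2 + k : ℝ) - 1 = k + 3 / 2 by ring, Real.rpow_add ha, Real.rpow_natCast]
  have h2 : (4 * a) ^ (3 / 2 : ℝ) = 8 * a ^ (3 / 2 : ℝ) := by
    rw [Real.mul_rpow (by norm_num) ha.le, show (4 : ℝ) = 2 ^ (2 : ℝ) by norm_num,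
      ← Real.rpow_mul (by norm_num)]
    norm_num
  have h3 : 1 / √(2 * Real.pi) * (√2)⁻¹ * (2 * Real.pi) = √Real.pi := by
    rw [Real.sqrt_mul (by norm_num)]
    have e2 : √2 * √2 = 2 := Real.mul_self_sqrt (by norm_num)
    have ep : √Real.pi * √Real.pi = Real.pi := Real.mul_self_sqrt hpi.le
    have p2 : 0 < √2 := Real.sqrt_pos.2 (by norm_num)
    have pp : 0 < √Real.pi := Real.sqrt_pos.2 hpi
    field_simp
    rw [sq, sq, e2, ep]
  have h4 : √Real.pi * (1 / k.factorial) / Real.Gamma (5 / 2 + k) =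
      8 * 4 ^ k * ((k + 1) / (2 * k + 3).factorial) := by
    generalize Real.Gamma (5 / 2 + k) = G at hG hdup
    field_simp
    linear_combination -hdup
  rw [h1, h2, mul_pow]
  linear_combination (1 / k.factorial) * (a ^ k * a ^ (3 / 2 : ℝ)) / Real.Gamma (5 / 2 + k) * h3 +
    a ^ k * a ^ (3 / 2 : ℝ) * h4

/-- Evaluation of the limiting contour integral. -/
lemma integral_limitExponent (b : ℝ) (η : ℂ) {ξ : ℝ} (hξ : ξ ∈ Set.Ioo (-2 : ℝ) 2) :
    1 / (√(2 * Real.pi) : ℂ) * ∫ u : ℝ, Complex.exp (limitExponent b η ξ u) =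
      ((Real.exp ((b - 3) / 2) * (4 - ξ ^ 2) ^ (3 / 2 : ℝ) : ℝ) : ℂ) *
        limitT ((√(4 - ξ ^ 2) : ℂ) * η) := by
  set a : ℝ := 1 - ξ ^ 2 / 4 with ha_def
  have h4a : 4 - ξ ^ 2 = 4 * a := by rw [ha_def]; ring
  -- The assumption |ξ| < 2 enters here: Hankel's formula needs a > 0.
  have ha : 0 < a := by
    have := mul_pos (sub_pos.2 hξ.2) (sub_pos.2 hξ.1)
    nlinarith
  rw [h4a]
  -- With z = 1 - iu, the k-th term of exp(-η²/z) raises the power z^(-5/2) to z^(-5/2-k).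
  set F : ℕ → ℝ → ℂ := fun k u => ((-η ^ 2) ^ k / k.factorial) *
    Complex.exp (-((5 / 2 + k : ℝ) : ℂ) * Complex.log (1 - u * Complex.I) +
      a * (1 - u * Complex.I)) with hF
  have hs : ∀ k : ℕ, (2 : ℝ) ≤ 5 / 2 + k := fun k => by
    have : (0 : ℝ) ≤ k := Nat.cast_nonneg k
    linarith
  have hFint : ∀ k, Integrable (F k) := fun k =>
    (integrable_exp_neg_mul_log (hs k) a).const_mul _
  -- A bound summable in k, which justifies integrating the series termwise.
  have hFnorm : ∀ k, ∫ u, ‖F k u‖ ≤ (‖η‖ ^ 2) ^ k / k.factorial * (Real.exp a * Real.pi) := by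
    intro k
    rw [← integral_univ_inv_one_add_sq, ← integral_const_mul, ← integral_const_mul]
    refine integral_mono (hFint k).norm
      ((integrable_inv_one_add_sq.const_mul _).const_mul _) fun u => ?_
    have hre : (a * (1 - u * Complex.I) : ℂ).re = a := by simp
    have hn : ‖(-η ^ 2) ^ k / (k.factorial : ℂ)‖ = (‖η‖ ^ 2) ^ k / k.factorial := by
      rw [norm_div, norm_pow, norm_neg, norm_pow, Complex.norm_natCast]
    simp only [hF]
    rw [norm_mul, hn, Complex.exp_add, norm_mul, Complex.norm_exp (a * _), hre,
      mul_comm (Real.exp a)]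
    gcongr
    exact norm_exp_neg_mul_log_le (hs k) u
  have hsum := hasSum_integral_of_summable_integral_norm hFint
    (Summable.of_nonneg_of_le (fun k => integral_nonneg fun u => norm_nonneg _) hFnorm
      ((Real.summable_pow_div_factorial _).mul_right _))
  have hlog2 : Complex.exp (-(1 / 2 * Complex.log 2)) = (((√2)⁻¹ : ℝ) : ℂ) := by
    have h : Complex.log 2 = ((Real.log 2 : ℝ) : ℂ) := by
      rw [Complex.ofReal_log (by norm_num)]; norm_num
    rw [h, show (-(1 / 2 * ((Real.log 2 : ℝ) : ℂ))) = ((-(Real.log 2 / 2) : ℝ) : ℂ) by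
      push_cast; ring, ← Complex.ofReal_exp, Real.exp_neg, ← Real.log_sqrt (by norm_num),
      Real.exp_log (Real.sqrt_pos.2 (by norm_num))]
  have hpoint : ∀ u : ℝ, Complex.exp (limitExponent b η ξ u) =
      ((Real.exp ((b - 3) / 2) * (√2)⁻¹ : ℝ) : ℂ) * ∑' k, F k u := by
    intro u
    have hre : (0 : ℝ) < (1 - u * Complex.I).re := by simp
    have hz0 : (1 - u * Complex.I) ≠ 0 := fun h => by rw [h] at hre; simp at hre
    have hexp : HasSum (fun k => F k u) (Complex.exp (-(5 / 2) * Complex.log (1 - u * Complex.I) +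
        a * (1 - u * Complex.I)) * Complex.exp (-η ^ 2 / (1 - u * Complex.I))) := by
      have h := NormedSpace.expSeries_div_hasSum_exp (𝔸 := ℂ) (-η ^ 2 / (1 - u * Complex.I))
      rw [← Complex.exp_eq_exp_ℂ] at h
      convert! h.mul_left _ using 1
      funext k
      simp only [hF]
      have hk : Complex.exp (-((5 / 2 + k : ℝ) : ℂ) * Complex.log (1 - u * Complex.I) +
          a * (1 - u * Complex.I)) = Complex.exp (-(5 / 2) * Complex.log (1 - u * Complex.I) +
          a * (1 - u * Complex.I)) / (1 - u * Complex.I) ^ k := by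
        rw [eq_div_iff (pow_ne_zero _ hz0)]
        nth_rewrite 3 [← Complex.exp_log hz0]
        rw [← Complex.exp_nat_mul, ← Complex.exp_add]
        congr 1
        push_cast
        ring
      rw [hk, div_pow]
      field_simp
    rw [hexp.tsum_eq, Complex.ofReal_mul, ← hlog2, Complex.ofReal_exp, ← Complex.exp_add,
      ← Complex.exp_add, ← Complex.exp_add, limitExponent, ha_def]
    congr 1
    push_cast
    ring
  simp only [hpoint]
  rw [integral_const_mul]
  have hT := (hasSum_limitT ((√(4 * a) : ℂ) * η)).mul_left
    ((Real.exp ((b - 3) / 2) * (4 * a) ^ (3 / 2 : ℝ) : ℝ) : ℂ)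
  have hS := (hsum.mul_left ((Real.exp ((b - 3) / 2) * (√2)⁻¹ : ℝ) : ℂ)).mul_left
    (1 / (√(2 * Real.pi) : ℂ))
  refine hS.unique ?_
  convert! hT using 1
  funext k
  simp only [hF]
  rw [integral_const_mul, integral_exp_neg_mul_log (hs k) ha]
  have hid := congrArg (fun t : ℝ => (t : ℂ)) (coefficient_identity ha k)
  simp only [Complex.ofReal_mul, Complex.ofReal_div, Complex.ofReal_one, Complex.ofReal_pow,
    Complex.ofReal_natCast] at hid
  have hsq : ((√(4 * a) : ℂ) * η) ^ (2 * k) = ((4 * a : ℝ) : ℂ) ^ k * (η ^ 2) ^ k := by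
    rw [mul_pow, pow_mul, pow_mul, ← Complex.ofReal_pow (√(4 * a)), Real.sq_sqrt (by positivity)]
  rw [hsq, neg_pow (η ^ 2)]
  simp only [Complex.ofReal_mul, Complex.ofReal_div]
  push_cast at hid ⊢
  linear_combination Complex.exp ((b - 3) / 2) * (-1) ^ k * (η ^ 2) ^ k * hid

end Hankel

theorem proposition3p1 {Ω : Type*} [MeasurableSpace Ω] (P : Measure Ω) [IsProbabilityMeasure P]
    (Q : Measure ℝ) [IsProbabilityMeasure Q] (hQ : HasWignerMoments Q)
    (X : ℕ → ℕ → Ω → ℝ) (hX : IsWignerArray P Q X)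
    (ξseq : ℕ → ℝ) (ξ : ℝ) (hξ : ξ ∈ Set.Ioo (-2 : ℝ) 2)
    (hlim : Tendsto (fun N : ℕ => ξseq N / √(N : ℝ)) atTop (𝓝 ξ)) (η : ℂ) :
    (∀ (N : ℕ) (μ ν : ℂ), Integrable (charPolyProduct X N μ ν) P) ∧
    Tendsto
      (fun N : ℕ =>
        ((√(2 * Real.pi / (N : ℝ) ^ 3) * (1 / (N.factorial : ℝ)) *
            Real.exp (-(ξseq N) ^ 2 / 2) : ℝ) : ℂ) *
          charPolyCorrelation P X N
            ((ξseq N : ℂ) + η / (√(N : ℝ) : ℂ)) ((ξseq N : ℂ) - η / (√(N : ℝ) : ℂ)))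
      atTop
      (𝓝 (((Real.exp (((∫ x, x ^ 4 ∂Q) - 3) / 2) * (4 - ξ ^ 2) ^ (3 / 2 : ℝ) : ℝ) : ℂ) *
        limitT ((√(4 - ξ ^ 2) : ℂ) * η))) := by
  refine ⟨fun N μ ν => hX.integrable_charPolyProduct hQ N μ ν, ?_⟩
  have h := tendsto_taylorCoef_genFun ((∫ x, x ^ 4 ∂Q : ℝ) : ℂ) η hlim
  rw [integral_limitExponent _ η hξ] at h
  refine h.congr fun N => ?_
  -- The spectral parameters vary with N, so the recursion is solved anew for each N.
  obtain ⟨D, D', S, R, hrec⟩ := isMinorRecursion_taylorCoef ((∫ x, x ^ 4 ∂Q : ℝ) : ℂ)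
    ((ξseq N : ℂ) + η / (√(N : ℝ) : ℂ)) ((ξseq N : ℂ) - η / (√(N : ℝ) : ℂ))
  rw [hX.charPolyCorrelation_eq hQ hrec N]
  have hf : (N.factorial : ℂ) ≠ 0 := by exact_mod_cast N.factorial_ne_zero
  push_cast
  field_simp
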